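/- Graphs are finite and may have loops and multiple edges. For a graph $G$, $d_G(v)$ denotes the degree of a vertex $v$ (a loop at $v$ counts twice), and for $A\subseteq V(G)$, $e_G(A)$ denotes the number of edges (loops included) with both ends in $A$. For an integer $m$, the graph $G$ is $m$-edge-connected if for every $A$ with $\emptyset\neq A\subsetneq V(G)$ at least $m$ edges of $G$ have exactly one end in $A$ (no condition if $m\le 0$). A factor of $G$ is a spanning subgraph of $G$. For a positive integer $k$, a function $f:V(G)\to\mathbb{Z}$ is compatible with $G$ modulo $k$ if for every partition of $V(G)$ into two (possibly empty) sets $X,Y$, either there is an integer $x$ with $0\le x\le e_G(X)$ and $\sum_{v\in X}f(v)-2x\equiv\sum_{v\in Y}f(v)\pmod k$, or there is an integer $y$ with $0\le y\le e_G(Y)$ and $\sum_{v\in X}f(v)\equiv\sum_{v\in Y}f(v)-2y\pmod k$. **Corollary.** Let $k$ be a positive integer, let $G$ be a $(6k-7)$-edge-connected graph, and let $f$ be a positive integer-valued function on $V(G)$ that is compatible with $G$ modulo $k$. If $$f(v)\le \tfrac12 d_G(v)\le f(v)+k-\tfrac12\qquad\text{for every } v\in V(G),$$ then $G$ has a factor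 $H$ such that $d_H(v)\in\{f(v),\,f(v)+k\}$ for every $v\in V(G)$. -/

import Mathlib

namespace Graph

variable {α β : Type*}

/-- The degree of `v` in the multigraph `G` (loops count twice). -/
noncomputable def degree (G : Graph α β) (v : α) : ℕ :=
  {e | G.IsNonloopAt e v}.ncard + 2 * {e | G.IsLoopAt e v}.ncard

/-- The set of edges of `G` with exactly one end in `A`. -/
def edgeCut (G : Graph α β) (A : Set α) : Set β :=
  {e | ∃ x ∈ A, ∃ y ∉ A, G.IsLink e x y}

/-- `G` is `m`-edge-connected: every edge cut has at least `m` edges. The number `m` is an integer,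
and the condition is void for `m ≤ 0`. -/
def IsEdgeConnected (G : Graph α β) (m : ℤ) : Prop :=
  ∀ A : Set α, A ⊂ V(G) → A.Nonempty → m ≤ ((G.edgeCut A).ncard : ℤ)

/-- The number of edges of `G` (loops included) with both ends in `A`. -/
noncomputable def numEdgesIn (G : Graph α β) (A : Set α) : ℕ :=
  {e | ∃ x ∈ A, ∃ y ∈ A, G.IsLink e x y}.ncard

/-- A residue-valued map `f` is compatible with `G` with respect to the bipartition `X, Y`. -/
def IsCompatibleWrt (G : Graph α β) {k : ℕ} (f : α → ZMod k) (X Y : Finset α) : Prop :=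
  (∃ x : ℕ, x ≤ G.numEdgesIn X ∧ ∑ v ∈ X, f v - 2 * (x : ZMod k) = ∑ v ∈ Y, f v) ∨
  (∃ y : ℕ, y ≤ G.numEdgesIn Y ∧ ∑ v ∈ X, f v = ∑ v ∈ Y, f v - 2 * (y : ZMod k))

/-- A residue-valued map `f` is compatible with the finite graph `G`: it is compatible with respect
to every bipartition `X, Y` of the vertex set. A part may be empty. -/
def IsCompatibleMod (G : Graph α β) {k : ℕ} (f : α → ZMod k) : Prop :=
  ∀ X Y : Finset α, Disjoint X Y → (X : Set α) ∪ (Y : Set α) = V(G) → G.IsCompatibleWrt f X Y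

end Graph

/-! Give each edge the sign +1 if it lies in the factor and -1 otherwise. Twice the factor degree at
`v` is then `d_G(v)` plus the sum of the signs at `v`, so one needs a signing whose sum at every `v`
is `2f(v) - d(v)` or `2f(v) - d(v) + 2k`.

Take a maximum cut `X`. Its edges make up at least half of every edge cut, so they form a
`(3k-3)`-edge-connected bipartite graph. Negate all contributions at the vertices outside `X`. An
edge across `X` now contributes opposite values to its ends, hence is an oriented edge; any other
edge is bidirected, contributing the same sign to both ends. The requirement becomes a window `{c, c
+ 2k}` with `-2k ≤ c ≤ 0` at each vertex (`SignedTarget`).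

`SignedTarget.hasSigning` removes bidirected edges while at least `k` remain: two of them sharing an
end, given opposite signs, act as one ordinary edge; otherwise a single one is signed and the
windows are shifted. With at most `k - 1` left, compatibility provides a total sign with the right
residue. All are then signed at once and become at most `2k - 2` preoriented edges to one outer
vertex.

What remains is an orientation theorem in the style of Lovász, Thomassen, Wu and Zhang,
`Extendable.hasOrientation`: if each proper cut has at least `2k - 2` edges plus the distance of its
target from `2kℤ`, and the outer vertex has small degree, the preorientation extends to one with
imbalances prescribed modulo `2k` and below `2k` in absolute value. The proof is by induction on the
number of vertices. Tight sets are contracted, so that larger cuts have two spare edges; a vertex of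
target 0 is removed by lifting its edges; and edges between targets of opposite signs are deleted.
Targets of one sign are reduced to these cases by changing the edges to the outer vertex. -/

open Finset

/-! ### Distance to the multiples of `2k`. -/

/-- The distance from `x` to the nearest multiple of `2 * k`. -/
def distMul (k x : ℤ) : ℤ := min (x % (2 * k)) (2 * k - x % (2 * k))

section distMul

variable {k : ℤ}

lemma exists_distMul_eq (k x : ℤ) (hk : 0 < k) : ∃ j : ℤ, distMul k x = |x - 2 * k * j| := by
  have h0 := Int.emod_nonneg x (show 2 * k ≠ 0 by omega)
  have h1 := Int.emod_lt_of_pos x (show 0 < 2 * k by omega)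
  have h2 := Int.emod_add_mul_ediv x (2 * k)
  rcases le_total (x % (2 * k)) (2 * k - x % (2 * k)) with h | h
  · refine ⟨x / (2 * k), ?_⟩
    rw [distMul, min_eq_left h, abs_of_nonneg] <;> linarith
  · refine ⟨x / (2 * k) + 1, ?_⟩
    rw [distMul, min_eq_right h, abs_of_nonpos] <;> linarith

lemma distMul_le_abs_sub (hk : 0 < k) (x j : ℤ) : distMul k x ≤ |x - 2 * k * j| := by
  have h0 := Int.emod_nonneg x (show 2 * k ≠ 0 by omega)
  have h1 := Int.emod_lt_of_pos x (show 0 < 2 * k by omega)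
  have h2 := Int.emod_add_mul_ediv x (2 * k)
  have h3 : x - 2 * k * j = x % (2 * k) + 2 * k * (x / (2 * k) - j) := by linarith
  rw [h3, distMul]
  rcases le_or_gt 0 (x / (2 * k) - j) with h | h
  · have := mul_nonneg (show 0 ≤ 2 * k by omega) h
    exact (min_le_left _ _).trans ((by linarith : _ ≤ _).trans (le_abs_self _))
  · have : 2 * k * (x / (2 * k) - j) ≤ 2 * k * (-1) :=
      mul_le_mul_of_nonneg_left (by omega) (by omega)
    exact (min_le_right _ _).trans ((by linarith : _ ≤ _).trans (neg_le_abs _))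

lemma distMul_nonneg (hk : 0 < k) (x : ℤ) : 0 ≤ distMul k x := by
  obtain ⟨j, hj⟩ := exists_distMul_eq k x hk
  exact hj ▸ abs_nonneg _

lemma distMul_le (k x : ℤ) : distMul k x ≤ k := by
  unfold distMul; omega

lemma distMul_le_abs (hk : 0 < k) (x : ℤ) : distMul k x ≤ |x| := by
  simpa using distMul_le_abs_sub hk x 0

lemma distMul_congr {x y : ℤ} (h : 2 * k ∣ x - y) : distMul k x = distMul k y := by
  have : x % (2 * k) = y % (2 * k) :=
    Int.emod_eq_emod_iff_emod_sub_eq_zero.2 (Int.emod_eq_zero_of_dvd h)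
  simp [distMul, this]

lemma distMul_le_add_abs (hk : 0 < k) (x y : ℤ) : distMul k x ≤ distMul k y + |x - y| := by
  obtain ⟨j, hj⟩ := exists_distMul_eq k y hk
  have h1 := distMul_le_abs_sub hk x j
  have h2 := abs_add_le (y - 2 * k * j) (x - y)
  rw [show y - 2 * k * j + (x - y) = x - 2 * k * j by ring] at h2
  omega

lemma distMul_eq_abs (hk : 0 < k) {x : ℤ} (hx : |x| ≤ k) : distMul k x = |x| := by
  refine le_antisymm (distMul_le_abs hk x) ?_
  obtain ⟨j, hj⟩ := exists_distMul_eq k x hk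
  rw [hj]
  rcases eq_or_ne j 0 with rfl | h
  · simp
  · have h1 : 2 * k ≤ |2 * k * j| := by
      rw [abs_mul, abs_of_pos (show 0 < 2 * k by omega)]
      exact le_mul_of_one_le_right (by omega) (Int.one_le_abs h)
    have h2 := abs_sub_abs_le_abs_sub (2 * k * j) x
    rw [abs_sub_comm] at h2
    omega

lemma distMul_add_le (hk : 0 < k) (x y : ℤ) : distMul k (x + y) ≤ distMul k x + distMul k y := by
  obtain ⟨i, hi⟩ := exists_distMul_eq k x hk
  obtain ⟨j, hj⟩ := exists_distMul_eq k y hk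
  rw [hi, hj]
  refine (distMul_le_abs_sub hk _ (i + j)).trans (le_trans (le_of_eq ?_) (abs_add_le _ _))
  ring_nf

lemma distMul_neg (hk : 0 < k) (x : ℤ) : distMul k (-x) = distMul k x := by
  have key : ∀ z, distMul k (-z) ≤ distMul k z := by
    intro z
    obtain ⟨j, hj⟩ := exists_distMul_eq k z hk
    have := distMul_le_abs_sub hk (-z) (-j)
    rw [hj, ← abs_neg (z - _)]
    convert this using 2
    ring
  refine le_antisymm (key x) ?_
  simpa using key (-x)

lemma two_dvd_distMul_sub (hk : 0 < k) (x : ℤ) : 2 ∣ distMul k x - x := by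
  obtain ⟨j, hj⟩ := exists_distMul_eq k x hk
  rw [hj]
  rcases abs_choice (x - 2 * k * j) with h | h <;> rw [h]
  · exact ⟨-(k * j), by ring⟩
  · exact ⟨k * j - x, by ring⟩

/-- Every integer is congruent modulo `2 * k` to an integer realising its distance. -/
lemma exists_abs_le_dvd_sub (hk : 0 < k) (x : ℤ) : ∃ y, |y| ≤ k ∧ 2 * k ∣ x - y := by
  obtain ⟨j, hj⟩ := exists_distMul_eq k x hk
  exact ⟨x - 2 * k * j, hj ▸ distMul_le k x, ⟨j, by ring⟩⟩

lemma two_dvd_of_two_mul_dvd {x : ℤ} (h : 2 * k ∣ x) : 2 ∣ x := (dvd_mul_right 2 k).trans h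

/-- An integer in the closed window that is not congruent to the ends is in the open window. -/
lemma abs_lt_two_mul_of_not_dvd {x b : ℤ} (h : 2 * k ∣ x - b) (hx : |x| ≤ 2 * k)
    (hb : ¬ 2 * k ∣ b) : |x| < 2 * k := by
  refine lt_of_le_of_ne hx fun hx' => hb ?_
  have : 2 * k ∣ x := by
    rw [← dvd_abs, hx']
  simpa using dvd_sub this h

lemma not_two_mul_dvd (hk : 0 < k) {b : ℤ} (hb : |b| ≤ k) (hb0 : b ≠ 0) : ¬ 2 * k ∣ b := by
  intro h
  have := Int.le_of_dvd (abs_pos.2 hb0) ((dvd_abs _ _).2 h)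
  omega

end distMul

/-! ### Multigraphs as multiplicity functions, and their cuts. -/

section Multiplicity

variable {α : Type*} [DecidableEq α]

/-- The multiplicity function of a single edge with ends `a` and `b`. -/
def edgeAt (a b x y : α) : ℤ := (if x = a ∧ y = b then 1 else 0) + if x = b ∧ y = a then 1 else 0

/-- The flow along a single arc from `a` to `b`. -/
def arcAt (a b x y : α) : ℤ := (if x = a ∧ y = b then 1 else 0) - if x = b ∧ y = a then 1 else 0

lemma edgeAt_comm (a b x y : α) : edgeAt a b x y = edgeAt a b y x := by
  unfold edgeAt; rw [add_comm]; simp only [and_comm]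

lemma arcAt_antisymm (a b x y : α) : arcAt a b x y = -arcAt a b y x := by
  unfold arcAt; simp only [and_comm]; ring

/-- The number of edges leaving `A`, for edge multiplicities `m` on `S` and `r` further edges from
each vertex to a vertex outside `S`. -/
def cutSum (S : Finset α) (m : α → α → ℤ) (r : α → ℤ) (A : Finset α) : ℤ :=
  ∑ x ∈ A, (∑ y ∈ S \ A, m x y + r x)

variable {S A : Finset α} {m : α → α → ℤ} {r : α → ℤ}

lemma sum_ite_and_eq (A B : Finset α) (a b : α) :
    ∑ x ∈ A, ∑ y ∈ B, (if x = a ∧ y = b then (1 : ℤ) else 0) = if a ∈ A ∧ b ∈ B then 1 else 0 := by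
  have : ∀ x y : α, (if x = a ∧ y = b then (1 : ℤ) else 0)
      = (if x = a then 1 else 0) * (if y = b then 1 else 0) := by
    intro x y; by_cases x = a <;> by_cases y = b <;> simp_all
  simp only [this, ← Finset.mul_sum, Finset.sum_ite_eq', ← Finset.sum_mul]
  by_cases a ∈ A <;> by_cases b ∈ B <;> simp_all

/-- Whether an edge with ends `a` and `b` leaves `A`. -/
def crossAt (a b : α) (A : Finset α) : ℤ :=
  (if a ∈ A ∧ b ∉ A then 1 else 0) + if b ∈ A ∧ a ∉ A then 1 else 0

lemma crossAt_nonneg (a b : α) (A : Finset α) : 0 ≤ crossAt a b A := by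
  unfold crossAt; split_ifs <;> omega

lemma crossAt_le_one (a b : α) (A : Finset α) : crossAt a b A ≤ 1 := by
  unfold crossAt
  by_cases a ∈ A <;> by_cases b ∈ A <;> simp_all

lemma crossAt_singleton {a b : α} (hab : a ≠ b) (x : α) :
    crossAt a b {x} = (if x = a then 1 else 0) + if x = b then 1 else 0 := by
  unfold crossAt
  simp only [mem_singleton]
  by_cases h1 : a = x
  · subst h1; simp [hab.symm, hab]
  · by_cases h2 : b = x
    · subst h2; simp [h1, Ne.symm hab]
    · simp [h1, h2, Ne.symm h1, Ne.symm h2]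

lemma edgeAt_arcAt_cases {a b : α} (hab : a ≠ b) (x y : α) :
    (x = a ∧ y = b ∧ edgeAt a b x y = 1 ∧ arcAt a b x y = 1) ∨
    (x = b ∧ y = a ∧ edgeAt a b x y = 1 ∧ arcAt a b x y = -1) ∨
    (edgeAt a b x y = 0 ∧ arcAt a b x y = 0 ∧ ¬(x = a ∧ y = b) ∧ ¬(x = b ∧ y = a)) := by
  unfold edgeAt arcAt
  by_cases h1 : x = a ∧ y = b
  · obtain ⟨rfl, rfl⟩ := h1; simp [hab]
  · by_cases h2 : x = b ∧ y = a
    · obtain ⟨rfl, rfl⟩ := h2; simp [Ne.symm hab]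
    · simp [h1, h2]

lemma cutSum_add_edgeAt {a b : α} (ha : a ∈ S) (hb : b ∈ S) (c : ℤ) :
    cutSum S (fun x y => m x y + c * edgeAt a b x y) r A = cutSum S m r A +
      c * crossAt a b A := by
  unfold crossAt
  have h1 := sum_ite_and_eq A (S \ A) a b
  have h2 := sum_ite_and_eq A (S \ A) b a
  simp only [mem_sdiff, ha, hb, true_and] at h1 h2
  rw [← h1, ← h2]
  simp only [cutSum, edgeAt, Finset.sum_add_distrib, ← Finset.mul_sum]
  ring

lemma cutSum_add_single (v : α) (c : ℤ) :
    cutSum S m (fun x => r x + if x = v then c else 0) A =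
      cutSum S m r A + if v ∈ A then c else 0 := by
  simp only [cutSum, Finset.sum_add_distrib, Finset.sum_ite_eq']
  ring

lemma sum_add_single (f : α → ℤ) (v : α) (c : ℤ) :
    ∑ x ∈ A, (f x + if x = v then c else 0) = ∑ x ∈ A, f x + if v ∈ A then c else 0 := by
  simp only [Finset.sum_add_distrib, Finset.sum_ite_eq']

lemma sum_arcAt {a b : α} (ha : a ∈ S) (hb : b ∈ S) (x : α) :
    ∑ y ∈ S, arcAt a b x y = (if x = a then 1 else 0) - if x = b then 1 else 0 := by
  unfold arcAt
  rw [Finset.sum_sub_distrib]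
  congr 1
  · by_cases h : x = a <;> simp [h, hb]
  · by_cases h : x = b <;> simp [h, ha]

/-- The parity of a cut is that of the sum of the degrees. -/
lemma two_dvd_cutSum_sub_sum (hm : ∀ x y, m x y = m y x) (hA : A ⊆ S) :
    2 ∣ cutSum S m r A - ∑ x ∈ A, cutSum S m r {x} := by
  induction A using Finset.induction_on with
  | empty => simp [cutSum]
  | insert a A ha ih =>
    rw [Finset.insert_subset_iff] at hA
    have ih := ih hA.2
    rw [Finset.sum_insert ha]
    have e1 : cutSum S m r (insert a A) =
        cutSum S m r {a} + cutSum S m r A - 2 * ∑ y ∈ A, m a y := by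
      unfold cutSum
      rw [Finset.sum_insert ha, Finset.sum_singleton]
      have h1 : ∑ y ∈ S \ {a}, m a y = ∑ y ∈ S \ insert a A, m a y + ∑ y ∈ A, m a y := by
        rw [← Finset.sum_union]
        · congr 1; ext y; simp only [mem_sdiff, mem_singleton, mem_union, mem_insert]
          constructor
          · rintro ⟨h1, h2⟩; by_cases y ∈ A <;> simp_all
          · rintro (⟨h1, h2⟩ | h)
            · simp_all
            · exact ⟨hA.2 h, fun h' => ha (h' ▸ h)⟩
        · rw [Finset.disjoint_left]; simp only [mem_sdiff, mem_insert]; tauto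
      have h2 : ∀ x, ∑ y ∈ S \ A, m x y = ∑ y ∈ S \ insert a A, m x y + m x a := by
        intro x
        rw [show S \ A = insert a (S \ insert a A) by
          ext y; simp only [mem_sdiff, mem_insert]
          constructor
          · rintro ⟨h1, h2⟩; by_cases y = a <;> simp_all
          · rintro (rfl | h)
            · exact ⟨hA.1, ha⟩
            · exact ⟨h.1, fun h' => h.2 (Or.inr h')⟩]
        rw [Finset.sum_insert (by simp)]; ring
      rw [h1]
      simp only [h2, Finset.sum_add_distrib]
      simp only [hm _ a]
      ring
    rw [e1]
    have : cutSum S m r {a} + cutSum S m r A - 2 * ∑ y ∈ A, m a y -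
      (cutSum S m r {a} + ∑ x ∈ A, cutSum S m r {x}) =
      (cutSum S m r A - ∑ x ∈ A, cutSum S m r {x}) - 2 * ∑ y ∈ A, m a y := by ring
    rw [this]
    exact dvd_sub ih (dvd_mul_right _ _)

end Multiplicity

/-! ### Preoriented configurations and contraction of tight sets. -/

/-- Edge multiplicities `m` on `S`, together with `r x` edges with net value `h x` that join `x` to
a preoriented vertex outside `S`, and prescribed imbalances `b` modulo `2 * k`, satisfying the
connectivity conditions under which the preorientation extends. The vertex `u` is exempt if
`b u = 0`. -/
structure Extendable {α : Type*} [DecidableEq α] (k : ℤ) (S : Finset α) (m : α → α → ℤ)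
    (r h b : α → ℤ) (u : α) : Prop where
  symm : ∀ x y, m x y = m y x
  nonneg : ∀ x ∈ S, ∀ y ∈ S, x ≠ y → 0 ≤ m x y
  abs_net_le : ∀ x ∈ S, |h x| ≤ r x
  net_parity : ∀ x ∈ S, 2 ∣ r x - h x
  abs_target_le : ∀ x ∈ S, |b x| ≤ k
  parity : ∀ x ∈ S, 2 ∣ cutSum S m r {x} - b x
  sum_dvd : 2 * k ∣ ∑ x ∈ S, b x - ∑ x ∈ S, h x
  sum_le : ∑ x ∈ S, r x ≤ 2 * k - 2 + distMul k (∑ x ∈ S, b x)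
  le_cut : ∀ A ⊂ S, A.Nonempty → (A = {u} → b u ≠ 0) →
    2 * k - 2 + distMul k (∑ x ∈ A, b x) ≤ cutSum S m r A

/-- There is an orientation of the multigraph with multiplicities `m` on `S` whose imbalances,
together with `h`, are `b` modulo `2 * k` and less than `2 * k` in absolute value. -/
def HasOrientation {α : Type*} (k : ℤ) (S : Finset α) (m : α → α → ℤ) (h b : α → ℤ) : Prop :=
  ∃ o : α → α → ℤ, (∀ x y, o x y = -o y x) ∧
    (∀ x ∈ S, ∀ y ∈ S, x ≠ y → |o x y| ≤ m x y ∧ 2 ∣ m x y - o x y) ∧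
    ∀ x ∈ S, 2 * k ∣ ∑ y ∈ S, o x y + h x - b x ∧ |∑ y ∈ S, o x y + h x| < 2 * k

section Contraction

variable {α : Type*} [DecidableEq α] {k : ℤ} {S A : Finset α} {m : α → α → ℤ} {r h b : α → ℤ}
  {u : α}

/-- Serves to distribute the net flow of a bundle of edges among its members: each term takes as
much of `t` as its own bound and the capacity of the remaining terms allow. -/
lemma exists_sum_eq_of_abs_le (A : Finset α) (g : α → ℤ) (hg : ∀ x ∈ A, 0 ≤ g x) (t : ℤ)
    (ht : |t| ≤ ∑ x ∈ A, g x) (ht2 : 2 ∣ ∑ x ∈ A, g x - t) :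
    ∃ f : α → ℤ, (∀ x ∈ A, |f x| ≤ g x ∧ 2 ∣ g x - f x) ∧ ∑ x ∈ A, f x = t := by
  induction A using Finset.induction_on generalizing t with
  | empty => exact ⟨0, by simp, by simp_all⟩
  | insert a A ha ih =>
    rw [Finset.sum_insert ha] at ht ht2
    have hga := hg a (mem_insert_self _ _)
    have hG : 0 ≤ ∑ x ∈ A, g x := Finset.sum_nonneg fun x hx => hg x (mem_insert_of_mem hx)
    rw [abs_le] at ht
    obtain ⟨c, hc1, hc2, hc3, hc4⟩ : ∃ c, |c| ≤ g a ∧ 2 ∣ g a - c ∧ |t - c| ≤ ∑ x ∈ A, g x ∧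
        2 ∣ ∑ x ∈ A, g x - (t - c) := by
      by_cases h : -(∑ x ∈ A, g x) ≤ t - g a
      · refine ⟨g a, by rw [abs_of_nonneg hga], by simp, abs_le.2 ⟨h, by omega⟩, ?_⟩
        omega
      · refine ⟨t + ∑ x ∈ A, g x, abs_le.2 ⟨by omega, by omega⟩, by omega,
          abs_le.2 ⟨by omega, by omega⟩, by omega⟩
    obtain ⟨f, hf1, hf2⟩ := ih (fun x hx => hg x (mem_insert_of_mem hx)) (t - c) hc3 hc4
    refine ⟨fun x => if x = a then c else f x, fun x hx => ?_, ?_⟩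
    · by_cases hxa : x = a
      · subst hxa; simpa using ⟨hc1, hc2⟩
      · simpa [hxa] using hf1 x ((mem_insert.1 hx).resolve_left hxa)
    · rw [Finset.sum_insert ha]
      have : ∑ x ∈ A, (if x = a then c else f x) = ∑ x ∈ A, f x :=
        Finset.sum_congr rfl fun x hx => if_neg (ne_of_mem_of_not_mem hx ha)
      rw [this, hf2]
      simp

/-- The sum of `g` over the fibre of `φ` over `x`. -/
def fiberSum (S : Finset α) (φ : α → α) (g : α → ℤ) (x : α) : ℤ := ∑ z ∈ S with φ z = x, g z

lemma cutSum_fiberSum {S' T : Finset α} {φ : α → α} (hφ : ∀ z ∈ S, φ z ∈ S') :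
    cutSum S' (fun x y => fiberSum S φ (fun z => fiberSum S φ (m z) y) x) (fiberSum S φ r) T =
      cutSum S m r {z ∈ S | φ z ∈ T} := by
  unfold cutSum fiberSum
  rw [Finset.sum_add_distrib, Finset.sum_add_distrib, Finset.sum_fiberwise_eq_sum_filter]
  congr 1
  have : S \ {z ∈ S | φ z ∈ T} = {z ∈ S | φ z ∈ S' \ T} := by
    ext z; simp only [mem_sdiff, mem_filter]
    exact ⟨fun h => ⟨h.1, hφ z h.1, fun h' => h.2 ⟨h.1, h'⟩⟩, fun h => ⟨h.1, fun h' => h.2.2 h'.2⟩⟩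
  rw [this, ← Finset.sum_fiberwise_eq_sum_filter]
  refine Finset.sum_congr rfl fun x _ => ?_
  rw [Finset.sum_comm]
  refine Finset.sum_congr rfl fun z _ => ?_
  rw [← Finset.sum_fiberwise_eq_sum_filter]

lemma Extendable.two_dvd_cutSum (H : Extendable k S m r h b u) (hA : A ⊆ S) :
    2 ∣ cutSum S m r A - ∑ x ∈ A, b x := by
  have h1 := two_dvd_cutSum_sub_sum (r := r) H.symm hA
  have h2 : (2 : ℤ) ∣ ∑ x ∈ A, (cutSum S m r {x} - b x) :=
    Finset.dvd_sum fun x hx => H.parity x (hA hx)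
  rw [Finset.sum_sub_distrib] at h2
  have := dvd_add h1 h2
  simpa using this

/-- A cut and the distance of its target have the same parity, so a cut that is not tight has two
spare edges. -/
lemma Extendable.two_mul_add_le_cut (hk : 0 < k) (H : Extendable k S m r h b u) (hA : A ⊆ S)
    (h : 2 * k - 2 + distMul k (∑ x ∈ A, b x) < cutSum S m r A) :
    2 * k + distMul k (∑ x ∈ A, b x) ≤ cutSum S m r A := by
  have h1 := H.two_dvd_cutSum hA
  have h2 := two_dvd_distMul_sub hk (∑ x ∈ A, b x)
  omega

/-- Cuts of the quotient are cuts of `S` by unions of fibres, so all conditions are inherited.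
Targets may change by multiples of `2k`, because a fibre's total must be brought back to absolute
value at most `k`. The hypothesis `hu` prevents a nontrivial set from pulling back to the exempt
singleton. -/
lemma Extendable.quotient (H : Extendable k S m r h b u) {S' : Finset α} {φ : α → α}
    {b' : α → ℤ} (hφ : ∀ z ∈ S, φ z ∈ S') (hφ' : ∀ x ∈ S', ∃ z ∈ S, φ z = x)
    (hb : ∀ x ∈ S', |b' x| ≤ k) (hb' : ∀ x ∈ S', 2 * k ∣ fiberSum S φ b x - b' x)
    (hu : ∀ T, T ⊆ S' → {z ∈ S | φ z ∈ T} = {u} → T = {u} ∧ b' u = b u) :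
    Extendable k S' (fun x y => fiberSum S φ (fun z => fiberSum S φ (m z) y) x)
      (fiberSum S φ r) (fiberSum S φ h) b' u := by
  have hsum : ∀ (T : Finset α) (g : α → ℤ),
      ∑ x ∈ T, fiberSum S φ g x = ∑ z ∈ S with φ z ∈ T, g z :=
    fun T g => Finset.sum_fiberwise_eq_sum_filter _ _ _ _
  have hall : {z ∈ S | φ z ∈ S'} = S := Finset.filter_true_of_mem hφ
  have hbT : ∀ T ⊆ S', 2 * k ∣ ∑ z ∈ S with φ z ∈ T, b z - ∑ x ∈ T, b' x := by
    intro T hT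
    rw [← hsum, ← Finset.sum_sub_distrib]
    exact Finset.dvd_sum fun x hx => hb' x (hT hx)
  refine ⟨fun x y => ?_, fun x hx y hy hxy => ?_, fun x hx => ?_, fun x hx => ?_, hb,
    fun x hx => ?_, ?_, ?_, fun T hT hne hTu => ?_⟩
  · unfold fiberSum
    rw [Finset.sum_comm]
    simp only [H.symm]
  · refine Finset.sum_nonneg fun z hz => Finset.sum_nonneg fun w hw => ?_
    rw [mem_filter] at hz hw
    exact H.nonneg z hz.1 w hw.1 fun h => hxy (hz.2 ▸ hw.2 ▸ h ▸ rfl)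
  · exact (Finset.abs_sum_le_sum_abs _ _).trans
      (Finset.sum_le_sum fun z hz => H.abs_net_le z (mem_filter.1 hz).1)
  · unfold fiberSum
    rw [← Finset.sum_sub_distrib]
    exact Finset.dvd_sum fun z hz => H.net_parity z (mem_filter.1 hz).1
  · rw [cutSum_fiberSum hφ]
    have h1 := H.two_dvd_cutSum (A := {z ∈ S | φ z ∈ ({x} : Finset α)}) (filter_subset _ _)
    have h2 := two_dvd_of_two_mul_dvd (hbT {x} (by simpa using hx))
    rw [Finset.sum_singleton] at h2
    simpa using dvd_add h1 h2
  · have := hbT S' subset_rfl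
    rw [hsum, hall]
    rw [hall] at this
    have := dvd_sub H.sum_dvd this
    refine (this).trans (dvd_of_eq ?_)
    ring
  · have := hbT S' subset_rfl
    rw [hall] at this
    rw [hsum, hall, ← distMul_congr this]
    exact H.sum_le
  · rw [cutSum_fiberSum hφ, ← distMul_congr (hbT T hT.1)]
    refine H.le_cut _ ?_ ?_ ?_
    · refine ⟨filter_subset _ _, fun hS => hT.2 fun x hx => ?_⟩
      obtain ⟨z, hz, rfl⟩ := hφ' x hx
      exact (mem_filter.1 (hS hz)).2
    · obtain ⟨x, hx⟩ := hne
      obtain ⟨z, hz, rfl⟩ := hφ' x (hT.1 hx)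
      exact ⟨z, mem_filter.2 ⟨hz, hx⟩⟩
    · intro hT'
      obtain ⟨h1, h2⟩ := hu T hT.1 hT'
      exact h2 ▸ hTu h1

/-- If `A` has few leaving edges, then after orienting those edges the inside of `A` satisfies the
conditions for extending that preorientation. -/
lemma Extendable.restrict (H : Extendable k S m r h b u) (hA : A ⊂ S)
    (hcut : cutSum S m r A ≤ 2 * k - 2 + distMul k (∑ x ∈ A, b x)) {f : α → α → ℤ}
    (hf : ∀ x ∈ A, ∀ y ∈ S \ A, |f x y| ≤ m x y ∧ 2 ∣ m x y - f x y)
    (hsum : 2 * k ∣ ∑ x ∈ A, b x - ∑ x ∈ A, (∑ y ∈ S \ A, f x y + h x)) :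
    Extendable k A m (fun x => ∑ y ∈ S \ A, m x y + r x) (fun x => ∑ y ∈ S \ A, f x y + h x)
      b u := by
  have hcutT : ∀ T ⊆ A, cutSum A m (fun x => ∑ y ∈ S \ A, m x y + r x) T = cutSum S m r T := by
    intro T hT
    unfold cutSum
    refine Finset.sum_congr rfl fun x _ => ?_
    rw [← add_assoc, ← Finset.sum_union]
    · congr 2
      ext y
      simp only [mem_union, mem_sdiff]
      constructor
      · rintro (⟨h1, h2⟩ | ⟨h1, h2⟩)
        · exact ⟨hA.1 h1, h2⟩
        · exact ⟨h1, fun h => h2 (hT h)⟩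
      · rintro ⟨h1, h2⟩
        by_cases hy : y ∈ A <;> tauto
    · rw [Finset.disjoint_left]; simp only [mem_sdiff]; tauto
  refine ⟨H.symm, fun x hx y hy => H.nonneg x (hA.1 hx) y (hA.1 hy), fun x hx => ?_, fun x hx => ?_,
    fun x hx => H.abs_target_le x (hA.1 hx), fun x hx => ?_, hsum, ?_, fun T hT hne hTu => ?_⟩
  · refine (abs_add_le _ _).trans (add_le_add ?_ (H.abs_net_le x (hA.1 hx)))
    exact (Finset.abs_sum_le_sum_abs _ _).trans (Finset.sum_le_sum fun y hy => (hf x hx y hy).1)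
  · have h1 := H.net_parity x (hA.1 hx)
    have h2 : (2 : ℤ) ∣ ∑ y ∈ S \ A, (m x y - f x y) := Finset.dvd_sum fun y hy => (hf x hx y hy).2
    rw [Finset.sum_sub_distrib] at h2
    refine (dvd_add h1 h2).trans (dvd_of_eq ?_)
    ring
  · rw [hcutT _ (by simpa using hx)]
    exact H.parity x (hA.1 hx)
  · exact hcut
  · rw [hcutT T hT.1]
    exact H.le_cut T (hT.trans hA) hne hTu

/-- Orient the graph with `A` contracted; then let the oriented edges leaving `A` serve as the
preorientation for the inside of `A`. Tightness is exactly the degree bound demanded at the outer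
vertex. -/
lemma Extendable.hasOrientation_of_tight (hk : 0 < k) (H : Extendable k S m r h b u) (hA : A ⊂ S)
    (hA2 : 2 ≤ #A) (hcut : cutSum S m r A ≤ 2 * k - 2 + distMul k (∑ x ∈ A, b x))
    (ih : ∀ (S' : Finset α) (m' : α → α → ℤ) (r' h' b' : α → ℤ), #S' < #S →
      Extendable k S' m' r' h' b' u → HasOrientation k S' m' h' b') :
    HasOrientation k S m h b := by
  -- The contracted vertex must not inherit the name of the exempt vertex, since its cut condition
  -- is needed.
  obtain ⟨a, haA, hau⟩ : ∃ a ∈ A, a ≠ u := Finset.exists_mem_ne (by omega) u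
  have haS := hA.1 haA
  obtain ⟨β, hβ, hβ'⟩ := exists_abs_le_dvd_sub hk (∑ x ∈ A, b x)
  set φ : α → α := fun z => if z ∈ A then a else z with hφdef
  set S' : Finset α := insert a (S \ A) with hS'
  set b' : α → ℤ := fun x => if x = a then β else b x with hb'
  have fib_a : {z ∈ S | φ z = a} = A := by
    ext z
    simp only [mem_filter, hφdef]
    constructor
    · rintro ⟨h1, h2⟩
      by_contra hz
      rw [if_neg hz] at h2
      exact hz (h2 ▸ haA)
    · intro hz; exact ⟨hA.1 hz, if_pos hz⟩
  have fib_x : ∀ x ∈ S \ A, {z ∈ S | φ z = x} = {x} := by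
    intro x hx
    rw [mem_sdiff] at hx
    ext z
    simp only [mem_filter, hφdef, mem_singleton]
    constructor
    · rintro ⟨h1, h2⟩
      by_cases hz : z ∈ A
      · rw [if_pos hz] at h2; exact absurd (h2 ▸ haA) hx.2
      · rwa [if_neg hz] at h2
    · rintro rfl; exact ⟨hx.1, if_neg hx.2⟩
  have haSA : a ∉ S \ A := by simp [haA]
  have hφ : ∀ z ∈ S, φ z ∈ S' := by
    intro z hz
    by_cases h : z ∈ A <;> simp [hφdef, hS', h, hz]
  have fs_a : ∀ g, fiberSum S φ g a = ∑ z ∈ A, g z := fun g => by rw [fiberSum, fib_a]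
  have fs_x : ∀ x ∈ S \ A, ∀ g, fiberSum S φ g x = g x := fun x hx g => by
    rw [fiberSum, fib_x x hx, Finset.sum_singleton]
  have hne : ∀ x ∈ S \ A, x ≠ a := fun x hx h => haSA (h ▸ hx)
  have HQ : Extendable k S' (fun x y => fiberSum S φ (fun z => fiberSum S φ (m z) y) x)
      (fiberSum S φ r) (fiberSum S φ h) b' u := by
    refine H.quotient hφ (fun x hx => ?_) (fun x hx => ?_) (fun x hx => ?_) (fun T hT hTu => ?_)
    · rcases mem_insert.1 hx with rfl | hx
      · exact ⟨x, haS, by simp [hφdef]⟩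
      · exact ⟨x, (mem_sdiff.1 hx).1, by simp [hφdef, (mem_sdiff.1 hx).2]⟩
    · rcases mem_insert.1 hx with rfl | hx
      · simpa [hb'] using hβ
      · simpa [hb', hne x hx] using H.abs_target_le x (mem_sdiff.1 hx).1
    · rcases mem_insert.1 hx with rfl | hx
      · simpa [hb', fs_a] using hβ'
      · simp [hb', hne x hx, fs_x x hx]
    · have huT : u ∈ {z ∈ S | φ z ∈ T} := by simp [hTu]
      rw [mem_filter] at huT
      have huA : u ∉ A := by
        intro hu
        have : A ⊆ {u} := by
          rw [← hTu]
          intro z hz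
          refine mem_filter.2 ⟨hA.1 hz, ?_⟩
          have := huT.2
          simp only [hφdef, if_pos hu] at this
          simpa only [hφdef, if_pos hz] using this
        have := Finset.card_le_card this
        simp at this
        omega
      refine ⟨?_, by simp [hb', Ne.symm hau]⟩
      have hu : u ∈ T := by simpa only [hφdef, if_neg huA] using huT.2
      refine Finset.Subset.antisymm (fun x hx => ?_) (by simpa using hu)
      rcases mem_insert.1 (hT hx) with rfl | hxS
      · have : x ∈ {z ∈ S | φ z ∈ T} := mem_filter.2 ⟨haS, by simpa [hφdef, haA] using hx⟩
        rwa [hTu] at this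
      · have : x ∈ {z ∈ S | φ z ∈ T} :=
          mem_filter.2 ⟨(mem_sdiff.1 hxS).1, by simpa [hφdef, (mem_sdiff.1 hxS).2] using hx⟩
        rwa [hTu] at this
  have hcardS' : #S' < #S := by
    have h1 := Finset.card_sdiff_add_card_eq_card hA.1
    rw [hS', Finset.card_insert_of_notMem haSA]
    omega
  obtain ⟨o₁, o₁_anti, o₁_le, o₁_sum⟩ := ih S' _ _ _ _ hcardS' HQ
  have ha' : a ∈ S' := mem_insert_self _ _
  have hS'x : ∀ x ∈ S \ A, x ∈ S' := fun x hx => mem_insert_of_mem hx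
  -- The flow from the contracted vertex to `y` is spread over the actual edges between `A` and `y`.
  have hdist : ∀ y ∈ S \ A, ∃ g : α → ℤ, (∀ x ∈ A, |g x| ≤ m x y ∧ 2 ∣ m x y - g x) ∧
      ∑ x ∈ A, g x = o₁ a y := by
    intro y hy
    have := o₁_le a ha' y (hS'x y hy) (hne y hy).symm
    simp only [fs_a, fs_x y hy] at this
    refine exists_sum_eq_of_abs_le A (fun x => m x y) (fun x hx => ?_) _ this.1 this.2
    exact H.nonneg x (hA.1 hx) y (mem_sdiff.1 hy).1 fun h => (mem_sdiff.1 hy).2 (h ▸ hx)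
  choose! g hg hgsum using hdist
  set f : α → α → ℤ := fun x y => g y x with hf
  have hsumA : 2 * k ∣ ∑ x ∈ A, b x - ∑ x ∈ A, (∑ y ∈ S \ A, f x y + h x) := by
    have h1 := (o₁_sum a ha').1
    rw [fs_a, hS', Finset.sum_insert haSA] at h1
    have h2 : o₁ a a = 0 := by have := o₁_anti a a; omega
    have h3 : ∑ y ∈ S \ A, o₁ a y = ∑ x ∈ A, ∑ y ∈ S \ A, f x y := by
      rw [Finset.sum_comm]
      exact Finset.sum_congr rfl fun y hy => (hgsum y hy).symm
    rw [h2, h3] at h1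
    have h4 : b' a = β := by simp [hb']
    rw [h4] at h1
    rw [Finset.sum_add_distrib]
    have := dvd_sub hβ' h1
    refine (this).trans (dvd_of_eq ?_)
    ring
  have hfm : ∀ x ∈ A, ∀ y ∈ S \ A, |f x y| ≤ m x y ∧ 2 ∣ m x y - f x y :=
    fun x hx y hy => hg y hy x hx
  obtain ⟨o₂, o₂_anti, o₂_le, o₂_sum⟩ := ih A _ _ _ _ (Finset.card_lt_card hA)
    (H.restrict hA hcut hfm hsumA)
  have hsplit : ∀ g : α → ℤ, ∑ y ∈ S, g y = ∑ y ∈ A, g y + ∑ y ∈ S \ A, g y := fun g => by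
    rw [add_comm, Finset.sum_sdiff hA.1]
  refine ⟨fun x y => if x ∈ A then (if y ∈ A then o₂ x y else f x y) else
    if y ∈ A then -f y x else o₁ x y, fun x y => ?_, fun x hx y hy hxy => ?_, fun x hx => ?_⟩
  · by_cases hx : x ∈ A <;> by_cases hy : y ∈ A <;> simp only [hx, hy, if_true, if_false]
    · exact o₂_anti x y
    · ring
    · exact o₁_anti x y
  · by_cases hxA : x ∈ A <;> by_cases hyA : y ∈ A <;> simp only [hxA, hyA, if_true, if_false]
    · exact o₂_le x hxA y hyA hxy
    · exact hfm x hxA y (mem_sdiff.2 ⟨hy, hyA⟩)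
    · have := hfm y hyA x (mem_sdiff.2 ⟨hx, hxA⟩)
      rw [abs_neg, H.symm x y]
      exact ⟨this.1, by omega⟩
    · have hx' : x ∈ S \ A := mem_sdiff.2 ⟨hx, hxA⟩
      have hy' : y ∈ S \ A := mem_sdiff.2 ⟨hy, hyA⟩
      have := o₁_le x (hS'x x hx') y (hS'x y hy') hxy
      simpa only [fs_x x hx', fs_x y hy'] using this
  · by_cases hxA : x ∈ A
    · have := o₂_sum x hxA
      have e : ∑ y ∈ S, (if x ∈ A then (if y ∈ A then o₂ x y else f x y) else
          if y ∈ A then -f y x else o₁ x y) + h x =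
          ∑ y ∈ A, o₂ x y + (∑ y ∈ S \ A, f x y + h x) := by
        rw [hsplit, ← add_assoc]
        congr 2
        · exact Finset.sum_congr rfl fun y hy => by simp [hxA, hy]
        · exact Finset.sum_congr rfl fun y hy => by simp [hxA, (mem_sdiff.1 hy).2]
      rw [e]
      exact this
    · have hx' : x ∈ S \ A := mem_sdiff.2 ⟨hx, hxA⟩
      have := o₁_sum x (hS'x x hx')
      have e : ∑ y ∈ S, (if x ∈ A then (if y ∈ A then o₂ x y else f x y) else
          if y ∈ A then -f y x else o₁ x y) = ∑ y ∈ S', o₁ x y := by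
        rw [hsplit, hS', Finset.sum_insert haSA]
        congr 1
        · rw [o₁_anti, ← hgsum x hx', ← Finset.sum_neg_distrib]
          exact Finset.sum_congr rfl fun y hy => by simp [hxA, hy, hf]
        · exact Finset.sum_congr rfl fun y hy => by simp [hxA, (mem_sdiff.1 hy).2]
      simp only [e]
      rw [fs_x x hx'] at this
      simpa [hb', hne x hx'] using this

end Contraction

/-! ### The one-vertex case, deletion of a vertex and lifting. -/

section Moves

variable {α : Type*} [DecidableEq α] {k : ℤ} {S A : Finset α} {m : α → α → ℤ} {r h b : α → ℤ}
  {u : α}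

lemma Extendable.cutSum_nonneg (H : Extendable k S m r h b u) (hA : A ⊆ S) :
    0 ≤ cutSum S m r A := by
  refine Finset.sum_nonneg fun x hx => add_nonneg (Finset.sum_nonneg fun y hy => ?_)
    ((abs_nonneg _).trans (H.abs_net_le x (hA hx)))
  rw [mem_sdiff] at hy
  exact H.nonneg x (hA hx) y hy.1 (ne_of_mem_of_not_mem hx hy.2)

/-- Only the size bound is at stake: if `|h x| ≥ 2k`, the distance of `h x` is at most `|h x| - 2k`,
contradicting the degree bound at the outer vertex. -/
lemma Extendable.hasOrientation_of_card_le_one (hk : 0 < k) (H : Extendable k S m r h b u)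
    (hS : #S ≤ 1) : HasOrientation k S m h b := by
  refine ⟨fun _ _ => 0, by simp, fun x hx y hy hxy => ?_, fun x hx => ?_⟩
  · exact absurd (Finset.card_le_one.1 hS x hx y hy) hxy
  · obtain rfl : S = {x} := Finset.eq_singleton_iff_unique_mem.2
      ⟨hx, fun y hy => Finset.card_le_one.1 hS y hy x hx⟩
    have h1 := H.sum_dvd
    have h2 := H.sum_le
    have h3 := H.abs_net_le x hx
    simp only [Finset.sum_singleton] at h1 h2
    simp only [Finset.sum_const_zero, zero_add]
    refine ⟨(dvd_neg.2 h1).trans (dvd_of_eq (by ring)), ?_⟩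
    by_contra hlt
    push Not at hlt
    rw [distMul_congr h1] at h2
    have h4 : distMul k (h x) ≤ |h x| - 2 * k := by
      rcases le_total 0 (h x) with h0 | h0
      · have := distMul_le_abs_sub hk (h x) 1
        rw [abs_of_nonneg h0] at hlt ⊢
        rwa [mul_one, abs_of_nonneg (by omega)] at this
      · have := distMul_le_abs_sub hk (h x) (-1)
        rw [abs_of_nonpos h0] at hlt ⊢
        rw [mul_neg, mul_one, abs_of_nonpos (by omega)] at this
        omega
    omega

lemma Extendable.neg (hk : 0 < k) (H : Extendable k S m r h b u) :
    Extendable k S m r (fun x => -h x) (fun x => -b x) u := by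
  refine ⟨H.symm, H.nonneg, fun x hx => ?_, fun x hx => ?_, fun x hx => ?_, fun x hx => ?_, ?_, ?_,
    fun A hA hne hu => ?_⟩
  · rw [abs_neg]; exact H.abs_net_le x hx
  · have := H.net_parity x hx; omega
  · rw [abs_neg]; exact H.abs_target_le x hx
  · have := H.parity x hx; omega
  · rw [Finset.sum_neg_distrib, Finset.sum_neg_distrib]
    exact (dvd_neg.2 H.sum_dvd).trans (dvd_of_eq (by ring))
  · rw [Finset.sum_neg_distrib, distMul_neg hk]; exact H.sum_le
  · rw [Finset.sum_neg_distrib, distMul_neg hk]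
    exact H.le_cut A hA hne fun h => by have := hu h; omega

lemma HasOrientation.of_neg (H : HasOrientation k S m (fun x => -h x) (fun x => -b x)) :
    HasOrientation k S m h b := by
  obtain ⟨o, h1, h2, h3⟩ := H
  refine ⟨fun x y => -o x y, fun x y => by beta_reduce; rw [h1 x y], fun x hx y hy hxy => ?_, fun x hx => ?_⟩
  · have := h2 x hx y hy hxy
    beta_reduce
    rw [abs_neg]
    exact ⟨this.1, by omega⟩
  · obtain ⟨h4, h5⟩ := h3 x hx
    rw [Finset.sum_neg_distrib, ← abs_neg]
    refine ⟨(dvd_neg.2 h4).trans (dvd_of_eq (by ring)), ?_⟩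
    convert h5 using 2
    ring

/-- Any vertex with prescribed value zero can be made the exempt one if none is exempt yet. -/
lemma Extendable.exists_exempt (H : Extendable k S m r h b u) {v : α} (hv : v ∈ S) (hbv : b v = 0) :
    ∃ w ∈ S, b w = 0 ∧ Extendable k S m r h b w := by
  by_cases hu : u ∈ S ∧ b u = 0
  · exact ⟨u, hu.1, hu.2, H⟩
  · refine ⟨v, hv, hbv, { H with le_cut := fun A hA hne _ => H.le_cut A hA hne fun hAu hbu => ?_ }⟩
    exact hu ⟨hA.1 (hAu ▸ mem_singleton_self u), hbu⟩

/-- Deleting an exempt vertex all of whose edges go to the same vertex. -/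
lemma Extendable.hasOrientation_of_unique_neighbor (H : Extendable k S m r h b u) (hu : u ∈ S)
    (hbu : b u = 0) (hr : r u = 0) {y : α} (hy : y ∈ S) (hyu : y ≠ u)
    (hm : ∀ w ∈ S, w ≠ u → w ≠ y → m u w = 0)
    (ih : ∀ (S' : Finset α) (m' : α → α → ℤ) (r' h' b' : α → ℤ) (u' : α), #S' < #S →
      Extendable k S' m' r' h' b' u' → HasOrientation k S' m' h' b') :
    HasOrientation k S m h b := by
  have hhu : h u = 0 := by
    have := H.abs_net_le u hu
    rw [hr] at this
    exact abs_eq_zero.1 (le_antisymm this (abs_nonneg _))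
  -- The target of `u` is 0, so its edges, all parallel, are even in number: half can be oriented
  -- each way, with net flow zero.
  have hmuy : 2 ∣ m u y := by
    have h1 := H.parity u hu
    have h2 : cutSum S m r {u} = m u y := by
      unfold cutSum
      rw [Finset.sum_singleton, hr, add_zero, Finset.sum_eq_single y]
      · intro w hw hwy
        rw [mem_sdiff, mem_singleton] at hw
        exact hm w hw.1 hw.2 hwy
      · intro h; exact absurd (mem_sdiff.2 ⟨hy, by simpa using hyu⟩) h
    rwa [h2, hbu, sub_zero] at h1
  -- Put `u` on the same side as its only neighbour `y`: the cut does not change, nor does the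
  -- target since `b u = 0`.
  have key : ∀ A ⊆ S.erase u, ∃ B ⊆ S, A ⊆ B ∧ B ⊆ insert u A ∧ cutSum (S.erase u) m r A =
      cutSum S m r B ∧ ∑ x ∈ A, b x = ∑ x ∈ B, b x := by
    intro A hA
    have huA : u ∉ A := fun h => by simpa using hA h
    by_cases hyA : y ∈ A
    · refine ⟨insert u A, Finset.insert_subset hu (hA.trans (erase_subset _ _)), subset_insert _ _,
        subset_rfl, ?_, by rw [Finset.sum_insert huA, hbu, zero_add]⟩
      unfold cutSum
      have e : S \ insert u A = S.erase u \ A := by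
        ext x; simp only [mem_sdiff, mem_insert, mem_erase]; tauto
      rw [Finset.sum_insert huA, e, hr, Finset.sum_eq_zero (s := S.erase u \ A)]
      · simp
      · intro w hw
        rw [mem_sdiff, mem_erase] at hw
        exact hm w hw.1.2 hw.1.1 fun h => hw.2 (h ▸ hyA)
    · refine ⟨A, hA.trans (erase_subset _ _), subset_rfl, subset_insert _ _, ?_, rfl⟩
      unfold cutSum
      refine Finset.sum_congr rfl fun x hx => ?_
      congr 1
      have e : S \ A = insert u (S.erase u \ A) := by
        ext z; simp only [mem_sdiff, mem_insert, mem_erase]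
        by_cases hz : z = u
        · subst hz; simp [hu, huA]
        · simp [hz]
      have hxS := mem_erase.1 (hA hx)
      rw [e, Finset.sum_insert (by simp), H.symm x u,
        hm x hxS.2 hxS.1 (fun h => hyA (h ▸ hx)), zero_add]
  have hsum : ∀ g : α → ℤ, g u = 0 → ∑ x ∈ S.erase u, g x = ∑ x ∈ S, g x := fun g hg =>
    Finset.sum_erase _ hg
  have HE : Extendable k (S.erase u) m r h b u := by
    refine ⟨H.symm, fun x hx y hy => H.nonneg x (mem_of_mem_erase hx) y (mem_of_mem_erase hy),
      fun x hx => H.abs_net_le x (mem_of_mem_erase hx),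
      fun x hx => H.net_parity x (mem_of_mem_erase hx),
      fun x hx => H.abs_target_le x (mem_of_mem_erase hx), fun x hx => ?_, ?_, ?_, fun A hA hne _ => ?_⟩
    · obtain ⟨B, hB, -, -, h1, h2⟩ := key {x} (by simpa using hx)
      rw [h1, ← Finset.sum_singleton b x, h2]
      exact H.two_dvd_cutSum hB
    · rw [hsum b hbu, hsum h hhu]; exact H.sum_dvd
    · rw [hsum b hbu, hsum r hr]; exact H.sum_le
    · obtain ⟨B, hB, hAB, hBA, h1, h2⟩ := key A hA.1
      rw [h1, h2]
      refine H.le_cut B ⟨hB, fun hSB => hA.2 fun x hx => ?_⟩ (hne.mono hAB) fun hBu => ?_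
      · rw [mem_erase] at hx
        exact (mem_insert.1 (hBA (hSB hx.2))).resolve_left hx.1
      · obtain ⟨x, hx⟩ := hne
        have := hAB hx
        rw [hBu, mem_singleton] at this
        subst this
        simpa using hA.1 hx
  obtain ⟨o, ho1, ho2, ho3⟩ := ih _ _ _ _ _ _ (Finset.card_erase_lt_of_mem hu) HE
  refine ⟨fun x y => if x = u ∨ y = u then 0 else o x y, fun x y => ?_, fun x hx z hz hxz => ?_,
    fun x hx => ?_⟩
  · by_cases hx : x = u <;> by_cases hy : y = u <;> simp [hx, hy, ho1 x y]
  · have even : ∀ w ∈ S, w ≠ u → 0 ≤ m u w ∧ 2 ∣ m u w := by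
      intro w hw hwu
      refine ⟨H.nonneg u hu w hw hwu.symm, ?_⟩
      by_cases hwy : w = y
      · exact hwy ▸ hmuy
      · simp [hm w hw hwu hwy]
    by_cases hxu : x = u
    · subst hxu; simpa using even z hz hxz.symm
    · by_cases hzu : z = u
      · subst hzu; rw [H.symm]; simpa using even x hx hxz
      · simp only [hxu, hzu, or_self, if_false]
        exact ho2 x (mem_erase.2 ⟨hxu, hx⟩) z (mem_erase.2 ⟨hzu, hz⟩) hxz
  · by_cases hxu : x = u
    · subst hxu
      have hk := H.abs_target_le x hx
      rw [hbu, abs_zero] at hk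
      simp only [true_or, if_true, Finset.sum_const_zero, hhu, hbu]
      have h5 := (ho3 y (mem_erase.2 ⟨hyu, hy⟩)).2
      have h6 := abs_nonneg (∑ z ∈ S.erase x, o y z + h y)
      simp
      omega
    · have e : ∑ z ∈ S, (if x = u ∨ z = u then 0 else o x z) = ∑ z ∈ S.erase u, o x z := by
        rw [← hsum (fun z => if x = u ∨ z = u then 0 else o x z) (by simp)]
        refine Finset.sum_congr rfl fun z hz => ?_
        simp [hxu, (mem_erase.1 hz).1]
      simp only [e]
      exact ho3 x (mem_erase.2 ⟨hxu, hx⟩)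

/-- Either the orientation exists, or larger sets have two spare leaving edges. -/
lemma Extendable.hasOrientation_or_slack (hk : 0 < k) (H : Extendable k S m r h b u)
    (ih : ∀ (S' : Finset α) (m' : α → α → ℤ) (r' h' b' : α → ℤ) (u' : α), #S' < #S →
      Extendable k S' m' r' h' b' u' → HasOrientation k S' m' h' b') :
    HasOrientation k S m h b ∨
      ∀ A ⊂ S, 2 ≤ #A → 2 * k + distMul k (∑ x ∈ A, b x) ≤ cutSum S m r A := by
  by_contra hcon
  push Not at hcon
  obtain ⟨h1, A, hA, hA2, hlt⟩ := hcon
  refine h1 (H.hasOrientation_of_tight hk hA hA2 ?_ fun S' m' r' h' b' hlt H' =>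
    ih S' m' r' h' b' u hlt H')
  by_contra hc
  exact absurd (H.two_mul_add_le_cut hk hA.1 (not_le.1 hc)) (not_le.2 hlt)

/-- The lifted edge `ac` is replaced by the path through `u` in the same direction, which leaves all
imbalances unchanged. -/
lemma HasOrientation.of_lift {a c : α} (hu : u ∈ S) (ha : a ∈ S) (hc : c ∈ S) (hau : a ≠ u)
    (hcu : c ≠ u) (hac : a ≠ c) (hm : 0 ≤ m a c) (hsymm : ∀ x y, m x y = m y x)
    (H : HasOrientation k S (fun x y => (m x y + -1 * edgeAt u a x y + -1 * edgeAt u c x y) +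
      1 * edgeAt a c x y) h b) : HasOrientation k S m h b := by
  obtain ⟨o, ho1, ho2, ho3⟩ := H
  -- The parallel edges `ac` are interchangeable; the one to be rerouted is taken in the direction
  -- of the net flow.
  obtain ⟨s, hs, hs'⟩ : ∃ s : ℤ, (s = 1 ∨ s = -1) ∧ |o a c - s| ≤ m a c := by
    have := ho2 a ha c hc hac
    beta_reduce at this
    have e1 : edgeAt u a a c = 0 := by simp [edgeAt, hau, hcu]
    have e2 : edgeAt u c a c = 0 := by simp [edgeAt, hau, hcu, hac]
    have e3 : edgeAt a c a c = 1 := by simp [edgeAt, hac]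
    rw [e1, e2, e3, abs_le] at this
    by_cases h0 : 0 ≤ o a c
    · refine ⟨1, Or.inl rfl, ?_⟩
      rw [abs_le]; omega
    · refine ⟨-1, Or.inr rfl, ?_⟩
      rw [abs_le]; omega
  refine ⟨fun x y => o x y + s * (arcAt a u x y + arcAt u c x y - arcAt a c x y), fun x y => ?_,
    fun x hx y hy hxy => ?_, fun x hx => ?_⟩
  · beta_reduce
    rw [ho1 x y, arcAt_antisymm a u, arcAt_antisymm u c, arcAt_antisymm a c]; ring
  · have h1 := ho2 x hx y hy hxy
    have h2 := ho1 a c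
    have h3 := hsymm a c
    beta_reduce at h1 ⊢
    rw [abs_le] at h1 hs' ⊢
    have ee : edgeAt u a x y = edgeAt a u x y := by unfold edgeAt; ring
    simp only [ee] at h1
    rcases edgeAt_arcAt_cases hau x y with ⟨rfl, rfl, p1, p2⟩ | ⟨rfl, rfl, p1, p2⟩ | ⟨p1, p2, -⟩ <;>
    rcases edgeAt_arcAt_cases hcu.symm x y with ⟨q3, q4, q1, q2⟩ | ⟨q3, q4, q1, q2⟩ | ⟨q1, q2, -⟩ <;>
    rcases edgeAt_arcAt_cases hac x y with ⟨t3, t4, t1, t2⟩ | ⟨t3, t4, t1, t2⟩ | ⟨t1, t2, -⟩ <;>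
    simp only [p1, p2, q1, q2, t1, t2] at h1 ⊢ <;>
    first
    | (exfalso; subst_vars; tauto)
    | (subst_vars; rcases hs with rfl | rfl <;> refine ⟨⟨?_, ?_⟩, ?_⟩ <;> omega)
  · have e : ∑ y ∈ S, (o x y + s * (arcAt a u x y + arcAt u c x y - arcAt a c x y)) =
        ∑ y ∈ S, o x y := by
      rw [Finset.sum_add_distrib, ← Finset.mul_sum, Finset.sum_sub_distrib, Finset.sum_add_distrib,
        sum_arcAt ha hu, sum_arcAt hu hc, sum_arcAt ha hc]
      ring
    simp only [e]
    exact ho3 x hx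

end Moves

/-! ### Eliminating a vertex of target zero. -/

section Reduction

variable {α : Type*} [DecidableEq α] {k : ℤ} {S A : Finset α} {m : α → α → ℤ} {r h b : α → ℤ}
  {u : α}

/-- Condition `le_cut` after a change of the multiplicities, when the larger sets have slack. -/
lemma le_cut_of_slack {m' : α → α → ℤ} {r' b' : α → ℤ} {v : α}
    (slack : ∀ A ⊂ S, 2 ≤ #A → 2 * k + distMul k (∑ x ∈ A, b x) ≤ cutSum S m r A)
    (hcut : ∀ A ⊆ S, cutSum S m r A - 2 - distMul k (∑ x ∈ A, b x) ≤
      cutSum S m' r' A - distMul k (∑ x ∈ A, b' x))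
    (hsingle : ∀ x ∈ S, (x = v → b' v ≠ 0) → 2 * k - 2 + distMul k (b' x) ≤ cutSum S m' r' {x}) :
    ∀ A ⊂ S, A.Nonempty → (A = {v} → b' v ≠ 0) →
      2 * k - 2 + distMul k (∑ x ∈ A, b' x) ≤ cutSum S m' r' A := by
  intro A hA hne hv
  rcases Nat.lt_or_ge 1 #A with hcard | hcard
  · have h1 := slack A hA hcard
    have h2 := hcut A hA.1
    omega
  · obtain ⟨x, rfl⟩ := Finset.card_eq_one.1 (le_antisymm hcard hne.card_pos)
    rw [Finset.sum_singleton]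
    exact hsingle x (hA.1 (mem_singleton_self x)) fun h => hv (by rw [h])

/-- Lifting lowers a cut by at most 2, which the slack of larger sets pays for. Singletons other
than `{u}` keep their degree, and `{u}` is exempt, so its degree may fall without bound. -/
lemma Extendable.lift (H : Extendable k S m r h b u)
    (slack : ∀ A ⊂ S, 2 ≤ #A → 2 * k + distMul k (∑ x ∈ A, b x) ≤ cutSum S m r A)
    (hbu : b u = 0) {a c : α} (hu : u ∈ S) (ha : a ∈ S) (hc : c ∈ S) (hau : a ≠ u)
    (hcu : c ≠ u) (hac : a ≠ c) (hma : 0 < m u a) (hmc : 0 < m u c)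
    (hsing : ∀ x ∈ S, x ≠ u → 2 * k - 2 + distMul k (b x) ≤ cutSum S m r {x}) :
    Extendable k S (fun x y => (m x y + -1 * edgeAt u a x y + -1 * edgeAt u c x y) +
      1 * edgeAt a c x y) r h b u ∧
    cutSum S (fun x y => (m x y + -1 * edgeAt u a x y + -1 * edgeAt u c x y) +
      1 * edgeAt a c x y) r {u} = cutSum S m r {u} - 2 := by
  have hcut : ∀ A, cutSum S (fun x y => (m x y + -1 * edgeAt u a x y + -1 * edgeAt u c x y) +
      1 * edgeAt a c x y) r A =
      cutSum S m r A - crossAt u a A - crossAt u c A + crossAt a c A := by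
    intro A
    rw [cutSum_add_edgeAt ha hc, cutSum_add_edgeAt hu hc, cutSum_add_edgeAt hu ha]
    ring
  have hcx : ∀ x, x ≠ u → crossAt u a {x} + crossAt u c {x} - crossAt a c {x} = 0 := by
    intro x hx
    rw [crossAt_singleton hau.symm, crossAt_singleton hcu.symm, crossAt_singleton hac]
    simp only [hx, if_false]; ring
  have hcu' : crossAt u a {u} = 1 ∧ crossAt u c {u} = 1 ∧ crossAt a c {u} = 0 := by
    rw [crossAt_singleton hau.symm, crossAt_singleton hcu.symm, crossAt_singleton hac]
    simp [hau.symm, hcu.symm]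
  refine ⟨⟨fun x y => ?_, fun x hx y hy hxy => ?_, H.abs_net_le, H.net_parity, H.abs_target_le,
    fun x hx => ?_, H.sum_dvd, H.sum_le, le_cut_of_slack slack (fun A hA => ?_)
    fun x hx hxu => ?_⟩, ?_⟩
  · rw [H.symm x y, edgeAt_comm u a, edgeAt_comm u c, edgeAt_comm a c]
  · have h1 := H.nonneg x hx y hy hxy
    have h2 := H.symm u a
    have h3 := H.symm u c
    rcases edgeAt_arcAt_cases hau.symm x y with ⟨p3, p4, p1, -⟩ | ⟨p3, p4, p1, -⟩ | ⟨p1, -⟩ <;>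
    rcases edgeAt_arcAt_cases hcu.symm x y with ⟨q3, q4, q1, -⟩ | ⟨q3, q4, q1, -⟩ | ⟨q1, -⟩ <;>
    rcases edgeAt_arcAt_cases hac x y with ⟨t3, t4, t1, -⟩ | ⟨t3, t4, t1, -⟩ | ⟨t1, -⟩ <;>
    simp only [p1, q1, t1] <;>
    first
    | (exfalso; subst_vars; tauto)
    | (subst_vars; omega)
  · rw [hcut]
    have h1 := H.parity x hx
    by_cases hxu : x = u
    · subst hxu
      rw [hcu'.1, hcu'.2.1, hcu'.2.2]; omega
    · have := hcx x hxu; omega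
  · rw [hcut]
    have h1 := crossAt_le_one u a A
    have h2 := crossAt_le_one u c A
    have h3 := crossAt_nonneg a c A
    omega
  · by_cases hxu' : x = u
    · exact absurd hbu (hxu hxu')
    · rw [hcut]
      have h1 := hsing x hx hxu'
      have h2 := hcx x hxu'
      omega
  · rw [hcut, hcu'.1, hcu'.2.1, hcu'.2.2]; ring

/-- Moving one edge from `u` to the outer vertex, along an edge from `u` to `y`, to `y`. -/
lemma Extendable.moveStub (H : Extendable k S m r h b u)
    (slack : ∀ A ⊂ S, 2 ≤ #A → 2 * k + distMul k (∑ x ∈ A, b x) ≤ cutSum S m r A)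
    (hbu : b u = 0) {y : α} {s : ℤ} (hu : u ∈ S) (hy : y ∈ S) (hyu : y ≠ u) (hm : 0 < m u y)
    (hs : s = 1 ∨ s = -1) (hsr : |h u - s| ≤ r u - 1)
    (hsing : ∀ x ∈ S, x ≠ u → 2 * k - 2 + distMul k (b x) ≤ cutSum S m r {x}) :
    Extendable k S (fun x z => m x z + -1 * edgeAt u y x z)
      (fun x => (r x + if x = u then -1 else 0) + if x = y then 1 else 0)
      (fun x => (h x + if x = u then -s else 0) + if x = y then s else 0) b u ∧
    cutSum S (fun x z => m x z + -1 * edgeAt u y x z)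
      (fun x => (r x + if x = u then -1 else 0) + if x = y then 1 else 0) {u} =
      cutSum S m r {u} - 2 := by
  have hcut : ∀ A, cutSum S (fun x z => m x z + -1 * edgeAt u y x z)
      (fun x => (r x + if x = u then -1 else 0) + if x = y then 1 else 0) A =
      cutSum S m r A - crossAt u y A - (if u ∈ A then 1 else 0) + if y ∈ A then 1 else 0 := by
    intro A
    rw [cutSum_add_single, cutSum_add_single, cutSum_add_edgeAt hu hy]
    split_ifs <;> ring
  have hsum : ∀ (g : α → ℤ) (c : ℤ),
      ∑ x ∈ S, ((g x + if x = u then -c else 0) + if x = y then c else 0) = ∑ x ∈ S, g x := by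
    intro g c
    rw [sum_add_single (fun x => g x + if x = u then -c else 0), sum_add_single]
    simp [hu, hy]
  refine ⟨⟨fun x z => ?_, fun x hx z hz hxz => ?_, fun x hx => ?_, fun x hx => ?_, H.abs_target_le,
    fun x hx => ?_, ?_, ?_, le_cut_of_slack slack (fun A hA => ?_) fun x hx hxu => ?_⟩, ?_⟩
  · rw [H.symm x z, edgeAt_comm]
  · have h1 := H.nonneg x hx z hz hxz
    have h2 := H.symm u y
    rcases edgeAt_arcAt_cases hyu.symm x z with ⟨p3, p4, p1, -⟩ | ⟨p3, p4, p1, -⟩ | ⟨p1, -⟩ <;>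
    simp only [p1] <;> subst_vars <;> omega
  · have h1 := H.abs_net_le x hx
    have h2 : |s| = 1 := by rcases hs with rfl | rfl <;> rfl
    by_cases hxu : x = u
    · subst hxu
      simpa [Ne.symm hyu, sub_eq_add_neg] using hsr
    · by_cases hxy : x = y
      · subst hxy
        simp only [hxu, if_false, if_true, add_zero]
        exact (abs_add_le _ _).trans (by omega)
      · simpa [hxu, hxy] using h1
  · have h1 := H.net_parity x hx
    split_ifs <;> rcases hs with rfl | rfl <;> omega
  · rw [hcut]
    have h1 := H.parity x hx
    rw [crossAt_singleton hyu.symm]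
    simp only [mem_singleton, eq_comm (a := u), eq_comm (a := y)]
    split_ifs <;> omega
  · rw [hsum h s]; exact H.sum_dvd
  · rw [hsum r 1]; exact H.sum_le
  · rw [hcut]
    have h1 := crossAt_le_one u y A
    unfold crossAt at h1 ⊢
    by_cases u ∈ A <;> by_cases y ∈ A <;> simp_all
  · by_cases hxu' : x = u
    · exact absurd hbu (hxu hxu')
    · rw [hcut, crossAt_singleton hyu.symm]
      have h1 := hsing x hx hxu'
      simp only [mem_singleton, hxu', Ne.symm hxu', eq_comm (a := y), if_false]
      split_ifs <;> omega
  · rw [hcut, crossAt_singleton hyu.symm]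
    simp [hyu, Ne.symm hyu]
    ring

lemma HasOrientation.of_moveStub {y : α} {s : ℤ} (hu : u ∈ S) (hy : y ∈ S) (hyu : y ≠ u)
    (hs : s = 1 ∨ s = -1) (hsymm : ∀ x y, m x y = m y x)
    (H : HasOrientation k S (fun x z => m x z + -1 * edgeAt u y x z)
      (fun x => (h x + if x = u then -s else 0) + if x = y then s else 0) b) :
    HasOrientation k S m h b := by
  obtain ⟨o, ho1, ho2, ho3⟩ := H
  refine ⟨fun x z => o x z + s * arcAt y u x z, fun x z => ?_, fun x hx z hz hxz => ?_,
    fun x hx => ?_⟩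
  · beta_reduce
    rw [ho1 x z, arcAt_antisymm y u]; ring
  · have h1 := ho2 x hx z hz hxz
    have h3 := hsymm u y
    beta_reduce at h1 ⊢
    rw [abs_le] at h1 ⊢
    have ee : edgeAt u y x z = edgeAt y u x z := by unfold edgeAt; ring
    rw [ee] at h1
    rcases edgeAt_arcAt_cases hyu x z with ⟨p3, p4, p1, p2⟩ | ⟨p3, p4, p1, p2⟩ | ⟨p1, p2, -⟩ <;>
    simp only [p1, p2] at h1 ⊢ <;>
    rcases hs with rfl | rfl <;> omega
  · have h1 := ho3 x hx
    have e : ∑ z ∈ S, (o x z + s * arcAt y u x z) + h x = ∑ z ∈ S, o x z +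
        ((h x + if x = u then -s else 0) + if x = y then s else 0) := by
      rw [Finset.sum_add_distrib, ← Finset.mul_sum, sum_arcAt hy hu]
      split_ifs <;> ring
    rw [e]
    exact h1

/-- The case of a vertex with prescribed value zero. -/
lemma Extendable.hasOrientation_of_exempt (hk : 0 < k) (H : Extendable k S m r h b u)
    (hS : 2 ≤ #S) (hu : u ∈ S) (hbu : b u = 0)
    (ih : ∀ (S' : Finset α) (m' : α → α → ℤ) (r' h' b' : α → ℤ) (u' : α), #S' < #S →
      Extendable k S' m' r' h' b' u' → HasOrientation k S' m' h' b') :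
    HasOrientation k S m h b := by
  -- Each lift, possibly with an edge to the outer vertex as one of the pair, lowers the degree of
  -- `u` by 2, until all edges of `u` lead to one vertex.
  induction hn : (cutSum S m r {u}).toNat using Nat.strong_induction_on generalizing m r h with
  | _ n IH =>
    subst hn
    rcases H.hasOrientation_or_slack hk ih with hdone | slack
    · exact hdone
    have hss : ∀ x ∈ S, {x} ⊂ S := fun x hx => by
      refine Finset.ssubset_iff_subset_ne.2 ⟨by simpa using hx, fun h => ?_⟩
      rw [← h, Finset.card_singleton] at hS
      omega
    have hsing : ∀ x ∈ S, x ≠ u → 2 * k - 2 + distMul k (b x) ≤ cutSum S m r {x} := by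
      intro x hx hxu
      have := H.le_cut {x} (hss x hx) (singleton_nonempty x)
        fun h => absurd (singleton_injective h) hxu
      rwa [Finset.sum_singleton] at this
    have hur := H.abs_net_le u hu
    by_cases h1 : ∃ a ∈ S, ∃ c ∈ S, a ≠ u ∧ c ≠ u ∧ a ≠ c ∧ 0 < m u a ∧ 0 < m u c
    · obtain ⟨a, ha, c, hc, hau, hcu, hac, hma, hmc⟩ := h1
      obtain ⟨H', hcut'⟩ := H.lift slack hbu hu ha hc hau hcu hac hma hmc hsing
      have hpos := H'.cutSum_nonneg (A := {u}) (by simpa using hu)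
      refine HasOrientation.of_lift hu ha hc hau hcu hac (H.nonneg a ha c hc hac) H.symm
        (IH _ ?_ H' rfl)
      rw [hcut'] at hpos ⊢
      omega
    by_cases h2 : ∃ y ∈ S, y ≠ u ∧ 0 < m u y ∧ 0 < r u
    · obtain ⟨y, hy, hyu, hm, hr⟩ := h2
      obtain ⟨s, hs, hsr⟩ : ∃ s : ℤ, (s = 1 ∨ s = -1) ∧ |h u - s| ≤ r u - 1 := by
        have := H.net_parity u hu
        rw [abs_le] at hur
        by_cases h0 : 0 ≤ h u
        · exact ⟨1, Or.inl rfl, abs_le.2 (by omega)⟩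
        · exact ⟨-1, Or.inr rfl, abs_le.2 (by omega)⟩
      obtain ⟨H', hcut'⟩ := H.moveStub slack hbu hu hy hyu hm hs hsr hsing
      have hpos := H'.cutSum_nonneg (A := {u}) (by simpa using hu)
      refine HasOrientation.of_moveStub hu hy hyu hs H.symm (IH _ ?_ H' rfl)
      rw [hcut'] at hpos ⊢
      omega
    have hr0 : 0 ≤ r u := (abs_nonneg _).trans hur
    push Not at h1 h2
    by_cases h3 : ∃ y ∈ S, y ≠ u ∧ 0 < m u y
    · obtain ⟨y, hy, hyu, hm⟩ := h3
      refine H.hasOrientation_of_unique_neighbor hu hbu (le_antisymm (h2 y hy hyu hm) hr0) hy hyu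
        (fun w hw hwu hwy => ?_) ih
      exact le_antisymm (h1 y hy w hw hyu hwu hwy.symm hm) (H.nonneg u hu w hw hwu.symm)
    · push Not at h3
      have hz : ∀ w ∈ S, w ≠ u → m u w = 0 := fun w hw hwu =>
        le_antisymm (h3 w hw hwu) (H.nonneg u hu w hw hwu.symm)
      obtain ⟨y, hy, hyu⟩ := Finset.exists_mem_ne (by omega : 1 < #S) u
      refine H.hasOrientation_of_unique_neighbor hu hbu (le_antisymm ?_ hr0) hy hyu
        (fun w hw hwu _ => hz w hw hwu) ih
      have hA : S.erase u ⊂ S := Finset.erase_ssubset hu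
      -- If `u` has no neighbour in `S`, the cut of `S.erase u` consists of edges to the outer
      -- vertex. The cut condition and the bound on `∑ r` then force `r u = 0`.
      have h4 := H.le_cut (S.erase u) hA ⟨y, mem_erase.2 ⟨hyu, hy⟩⟩ fun h => by
        have : u ∈ S.erase u := h ▸ mem_singleton_self u
        simp at this
      have h5 : cutSum S m r (S.erase u) = ∑ x ∈ S.erase u, r x := by
        refine Finset.sum_congr rfl fun x hx => ?_
        rw [mem_erase] at hx
        rw [Finset.sdiff_erase_self hu, Finset.sum_singleton, H.symm, hz x hx.2 hx.1, zero_add]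
      have h6 := Finset.add_sum_erase S r hu
      have h7 := Finset.add_sum_erase S b hu
      have h8 := H.sum_le
      rw [hbu, zero_add] at h7
      rw [h7, h5] at h4
      omega

lemma Extendable.hasOrientation_of_zero (hk : 0 < k) (H : Extendable k S m r h b u)
    (hS : 2 ≤ #S) {v : α} (hv : v ∈ S) (hbv : b v = 0)
    (ih : ∀ (S' : Finset α) (m' : α → α → ℤ) (r' h' b' : α → ℤ) (u' : α), #S' < #S →
      Extendable k S' m' r' h' b' u' → HasOrientation k S' m' h' b') :
    HasOrientation k S m h b := by
  obtain ⟨w, hw, hbw, H'⟩ := H.exists_exempt hv hbv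
  exact H'.hasOrientation_of_exempt hk hS hw hbw ih

end Reduction

/-! ### Targets of mixed signs, targets of one sign, and the orientation theorem. -/

section Orientation

variable {α : Type*} [DecidableEq α] {k : ℤ} {S A : Finset α} {m : α → α → ℤ} {r h b : α → ℤ}
  {u : α}

/-- If the prescribed values take both signs then some edge joins vertices of opposite sign. -/
lemma Extendable.exists_edge_of_mixed (hk : 0 < k) (H : Extendable k S m r h b u)
    (slack : ∀ A ⊂ S, 2 ≤ #A → 2 * k + distMul k (∑ x ∈ A, b x) ≤ cutSum S m r A)
    (hz : ∀ x ∈ S, b x ≠ 0) (hp : ∃ x ∈ S, 0 < b x) (hn : ∃ x ∈ S, b x < 0) :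
    ∃ x ∈ S, ∃ y ∈ S, 0 < b x ∧ b y < 0 ∧ 0 < m x y := by
  by_contra hcon
  push Not at hcon
  obtain ⟨p, hpS, hp⟩ := hp
  obtain ⟨q, hqS, hq⟩ := hn
  set C : Finset α := {x ∈ S | 0 < b x} with hC
  set D : Finset α := {x ∈ S | b x < 0} with hD
  have hm : ∀ x ∈ C, ∀ y ∈ D, m x y = 0 := by
    intro x hx y hy
    rw [mem_filter] at hx hy
    refine le_antisymm (hcon x hx.1 y hy.1 hx.2 hy.2) (H.nonneg x hx.1 y hy.1 fun h => ?_)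
    subst h; omega
  have hSC : S \ C = D := by
    ext x
    simp only [mem_sdiff, hC, hD, mem_filter]
    constructor
    · rintro ⟨h1, h2⟩
      have := hz x h1
      exact ⟨h1, by by_contra h3; exact h2 ⟨h1, by omega⟩⟩
    · rintro ⟨h1, h2⟩
      exact ⟨h1, fun h3 => by omega⟩
  have hCS : C ⊆ S := filter_subset _ _
  have hSD : S \ D = C := by rw [← hSC, Finset.sdiff_sdiff_eq_self hCS]
  have hDS : D ⊆ S := filter_subset _ _
  have hpC : p ∈ C := mem_filter.2 ⟨hpS, hp⟩
  have hqD : q ∈ D := mem_filter.2 ⟨hqS, hq⟩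
  have hCS' : C ⊂ S := ⟨hCS, fun h => by have := (mem_filter.1 (h hqS)).2; omega⟩
  have hDS' : D ⊂ S := ⟨hDS, fun h => by have := (mem_filter.1 (h hpS)).2; omega⟩
  have cutC : cutSum S m r C = ∑ x ∈ C, r x :=
    Finset.sum_congr rfl fun x hx => by
      rw [hSC, Finset.sum_eq_zero fun y hy => hm x hx y hy, zero_add]
  have cutD : cutSum S m r D = ∑ x ∈ D, r x :=
    Finset.sum_congr rfl fun x hx => by
      rw [hSD, Finset.sum_eq_zero fun y hy => by rw [H.symm]; exact hm y hy x hx, zero_add]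
  have hr := Finset.sum_sdiff (f := r) hCS
  have hb := Finset.sum_sdiff (f := b) hCS
  rw [hSC] at hr hb
  have hle := H.sum_le
  -- With no edge between `C` and `D`, both cuts go to the outer vertex, whose degree is at most `2k
  -- - 2` plus the distance of the total. Subadditivity of the distance contradicts this as soon as
  -- one cut has slack.
  have hadd := distMul_add_le hk (∑ x ∈ D, b x) (∑ x ∈ C, b x)
  rw [hb] at hadd
  have hu : ∀ {A : Finset α}, A ⊂ S → (A = {u} → b u ≠ 0) := fun hA h =>
    hz u (hA.1 (h ▸ mem_singleton_self u))
  have hC1 := H.le_cut C hCS' ⟨p, hpC⟩ (hu hCS')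
  have hD1 := H.le_cut D hDS' ⟨q, hqD⟩ (hu hDS')
  rcases Nat.lt_or_ge 1 #C with hcard | hcard
  · have := slack C hCS' hcard; omega
  rcases Nat.lt_or_ge 1 #D with hcard' | hcard'
  · have := slack D hDS' hcard'; omega
  have eC : C = {p} := Finset.eq_singleton_iff_unique_mem.2
    ⟨hpC, fun y hy => Finset.card_le_one.1 hcard y hy p hpC⟩
  have eD : D = {q} := Finset.eq_singleton_iff_unique_mem.2
    ⟨hqD, fun y hy => Finset.card_le_one.1 hcard' y hy q hqD⟩
  rw [eC, eD, Finset.sum_singleton, Finset.sum_singleton] at hb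
  rw [cutC] at hC1
  rw [cutD] at hD1
  rw [eC] at hC1 hr
  rw [eD] at hD1 hr
  simp only [Finset.sum_singleton] at hC1 hD1 hr
  rw [distMul_eq_abs hk (H.abs_target_le p hpS), abs_of_pos hp] at hC1
  rw [distMul_eq_abs hk (H.abs_target_le q hqS), abs_of_neg hq] at hD1
  have h1 := distMul_le_abs hk (∑ x ∈ S, b x)
  rw [← hb] at h1 hle
  -- For `k = 1` subadditivity alone gives no contradiction; the opposite signs make the inequality
  -- strict.
  have h2 : |b q + b p| ≤ b p - b q - 2 := abs_le.2 (by omega)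
  omega

/-- Orienting the edge from `p` to `q` moves both targets one step towards 0, so degree and distance
drop together at `p` and `q`. For a larger set the cut drops by at most 1 and the distance rises by
at most 1, which the slack covers. -/
lemma Extendable.deleteEdge (hk : 0 < k) (H : Extendable k S m r h b u)
    (slack : ∀ A ⊂ S, 2 ≤ #A → 2 * k + distMul k (∑ x ∈ A, b x) ≤ cutSum S m r A)
    (hz : ∀ x ∈ S, b x ≠ 0) {p q : α} (hp : p ∈ S) (hq : q ∈ S) (hbp : 0 < b p) (hbq : b q < 0)
    (hm : 0 < m p q) (hS : 2 ≤ #S) :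
    Extendable k S (fun x y => m x y + -1 * edgeAt p q x y) r h
      (fun x => (b x + if x = p then -1 else 0) + if x = q then 1 else 0) u := by
  have hpq : p ≠ q := by rintro rfl; omega
  have hcut : ∀ A, cutSum S (fun x y => m x y + -1 * edgeAt p q x y) r A =
      cutSum S m r A - crossAt p q A := by
    intro A; rw [cutSum_add_edgeAt hp hq]; ring
  have hsum : ∀ A : Finset α, ∑ x ∈ A, ((b x + if x = p then -1 else 0) + if x = q then 1 else 0) =
      ∑ x ∈ A, b x + (if p ∈ A then -1 else 0) + if q ∈ A then 1 else 0 := by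
    intro A
    rw [sum_add_single (fun x => b x + if x = p then -1 else 0), sum_add_single]
  have hss : ∀ x ∈ S, {x} ⊂ S := fun x hx => by
    refine Finset.ssubset_iff_subset_ne.2 ⟨by simpa using hx, fun h => ?_⟩
    rw [← h, Finset.card_singleton] at hS
    omega
  have habs : ∀ x ∈ S, |(b x + if x = p then -1 else 0) + if x = q then 1 else 0| =
      |b x| - crossAt p q {x} := by
    intro x hx
    rw [crossAt_singleton hpq]
    by_cases hxp : x = p
    · subst hxp
      simp only [hpq, if_true, if_false, add_zero]
      rw [abs_of_pos hbp, abs_of_nonneg (by omega)]; ring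
    · by_cases hxq : x = q
      · subst hxq
        simp only [hxp, if_true, if_false, add_zero, zero_add]
        rw [abs_of_neg hbq, abs_of_nonpos (by omega)]; ring
      · simp [hxp, hxq]
  have hle : ∀ x ∈ S, |(b x + if x = p then -1 else 0) + if x = q then 1 else 0| ≤ k := by
    intro x hx
    rw [habs x hx]
    have := H.abs_target_le x hx
    have := crossAt_nonneg p q {x}
    omega
  refine ⟨fun x y => ?_, fun x hx y hy hxy => ?_, H.abs_net_le, H.net_parity, hle,
    fun x hx => ?_, ?_, ?_, le_cut_of_slack (v := u) (m' := fun x y => m x y + -1 * edgeAt p q x y)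
      (b' := fun x => (b x + if x = p then -1 else 0) + if x = q then 1 else 0)
      slack (fun A hA => ?_) fun x hx _ => ?_⟩
  · rw [H.symm x y, edgeAt_comm]
  · have h1 := H.nonneg x hx y hy hxy
    have h2 := H.symm p q
    rcases edgeAt_arcAt_cases hpq x y with ⟨p3, p4, p1, -⟩ | ⟨p3, p4, p1, -⟩ | ⟨p1, -⟩ <;>
    simp only [p1] <;> subst_vars <;> omega
  · rw [hcut, crossAt_singleton hpq]
    have h1 := H.parity x hx
    split_ifs <;> omega
  · rw [hsum, if_pos hp, if_pos hq]
    simpa using H.sum_dvd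
  · rw [hsum, if_pos hp, if_pos hq]
    simpa using H.sum_le
  · rw [hcut, hsum]
    have h1 := distMul_le_add_abs hk
      (∑ x ∈ A, b x + (if p ∈ A then -1 else 0) + if q ∈ A then 1 else 0) (∑ x ∈ A, b x)
    have h2 := crossAt_le_one p q A
    have h3 : |∑ x ∈ A, b x + (if p ∈ A then -1 else 0) + (if q ∈ A then 1 else 0) -
        ∑ x ∈ A, b x| ≤ 1 := by
      rw [abs_le]; split_ifs <;> omega
    omega
  · rw [hcut, distMul_eq_abs hk (hle x hx), habs x hx]
    have h1 := H.le_cut {x} (hss x hx) (singleton_nonempty x) fun h => by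
      rw [← singleton_injective h]; exact hz x hx
    rw [Finset.sum_singleton, distMul_eq_abs hk (H.abs_target_le x hx)] at h1
    omega

/-- Changing the net value and the target at a vertex by the same amount modulo `2 * k`. -/
lemma HasOrientation.of_change (hk : 0 < k) {v : α} {d e : ℤ} (hde : 2 * k ∣ e - d)
    (hz : b v ≠ 0) (hbv : |b v| ≤ k)
    (hbound : ∀ t : ℤ, 2 * k ∣ t - (b v + e) → |t| < 2 * k → |t - d| ≤ 2 * k)
    (H : HasOrientation k S m (fun x => h x + if x = v then d else 0)
      (fun x => b x + if x = v then e else 0)) : HasOrientation k S m h b := by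
  obtain ⟨o, ho1, ho2, ho3⟩ := H
  refine ⟨o, ho1, ho2, fun x hx => ?_⟩
  obtain ⟨h1, h2⟩ := ho3 x hx
  by_cases hxv : x = v
  · subst hxv
    simp only [if_true] at h1 h2
    have h3 : 2 * k ∣ ∑ y ∈ S, o x y + h x - b x :=
      (dvd_add h1 hde).trans (dvd_of_eq (by ring))
    -- The change could bring the imbalance to `±2k`, but the target is nonzero modulo `2k`.
    refine ⟨h3, abs_lt_two_mul_of_not_dvd h3 ?_ (not_two_mul_dvd hk hbv hz)⟩
    have := hbound _ h1 h2
    convert this using 2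
    ring
  · simp only [hxv, if_false, add_zero] at h1 h2
    exact ⟨h1, h2⟩

lemma HasOrientation.of_deleteEdge (hk : 0 < k) {p q : α} (hp : p ∈ S) (hq : q ∈ S)
    (hbp : 0 < b p) (hbq : b q < 0) (hpk : |b p| ≤ k) (hqk : |b q| ≤ k)
    (hsymm : ∀ x y, m x y = m y x)
    (H : HasOrientation k S (fun x y => m x y + -1 * edgeAt p q x y) h
      (fun x => (b x + if x = p then -1 else 0) + if x = q then 1 else 0)) :
    HasOrientation k S m h b := by
  have hpq : p ≠ q := by rintro rfl; omega
  obtain ⟨o, ho1, ho2, ho3⟩ := H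
  refine ⟨fun x y => o x y + arcAt p q x y, fun x y => ?_, fun x hx y hy hxy => ?_,
    fun x hx => ?_⟩
  · beta_reduce
    rw [ho1 x y, arcAt_antisymm p q]; ring
  · have h1 := ho2 x hx y hy hxy
    have h3 := hsymm p q
    beta_reduce at h1 ⊢
    rw [abs_le] at h1 ⊢
    rcases edgeAt_arcAt_cases hpq x y with ⟨p3, p4, p1, p2⟩ | ⟨p3, p4, p1, p2⟩ | ⟨p1, p2, -⟩ <;>
    simp only [p1, p2] at h1 ⊢ <;> omega
  · obtain ⟨h1, h2⟩ := ho3 x hx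
    have e : ∑ y ∈ S, (o x y + arcAt p q x y) + h x = (∑ y ∈ S, o x y + h x) +
        ((if x = p then 1 else 0) - if x = q then 1 else 0) := by
      rw [Finset.sum_add_distrib, sum_arcAt hp hq]; ring
    simp only [e]
    have h3 : 2 * k ∣ (∑ y ∈ S, o x y + h x) +
        ((if x = p then 1 else 0) - if x = q then 1 else 0) - b x := by
      refine h1.trans (dvd_of_eq ?_)
      beta_reduce
      split_ifs <;> ring
    refine ⟨h3, ?_⟩
    by_cases hxp : x = p
    · subst hxp
      refine abs_lt_two_mul_of_not_dvd h3 ?_ (not_two_mul_dvd hk hpk hbp.ne')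
      rw [abs_lt] at h2
      rw [abs_le]
      split_ifs <;> omega
    · by_cases hxq : x = q
      · subst hxq
        refine abs_lt_two_mul_of_not_dvd h3 ?_ (not_two_mul_dvd hk hqk hbq.ne)
        rw [abs_lt] at h2
        rw [abs_le]
        split_ifs <;> omega
      · simpa [hxp, hxq] using h2

/-- Each deletion lowers the sum of the `|b x|`. The hypothesis allows a zero target because a
deletion may produce one, at which point the exempt-vertex case finishes. -/
lemma Extendable.hasOrientation_of_mixed (hk : 0 < k) (H : Extendable k S m r h b u)
    (hS : 2 ≤ #S) (hb : (∃ x ∈ S, b x = 0) ∨ ((∃ x ∈ S, 0 < b x) ∧ ∃ x ∈ S, b x < 0))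
    (ih : ∀ (S' : Finset α) (m' : α → α → ℤ) (r' h' b' : α → ℤ) (u' : α), #S' < #S →
      Extendable k S' m' r' h' b' u' → HasOrientation k S' m' h' b') :
    HasOrientation k S m h b := by
  induction hn : (∑ x ∈ S, |b x|).toNat using Nat.strong_induction_on generalizing m b with
  | _ n IH =>
    subst hn
    by_cases hz : ∃ x ∈ S, b x = 0
    · obtain ⟨v, hv, hbv⟩ := hz
      exact H.hasOrientation_of_zero hk hS hv hbv ih
    obtain ⟨hpos, hneg⟩ := hb.resolve_left hz
    push Not at hz
    rcases H.hasOrientation_or_slack hk ih with hdone | slack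
    · exact hdone
    obtain ⟨p, hp, q, hq, hbp, hbq, hm⟩ := H.exists_edge_of_mixed hk slack hz hpos hneg
    have hpq : p ≠ q := by rintro rfl; omega
    refine HasOrientation.of_deleteEdge hk hp hq hbp hbq (H.abs_target_le p hp)
      (H.abs_target_le q hq) H.symm
      (IH _ ?_ (H.deleteEdge hk slack hz hp hq hbp hbq hm hS) ?_ rfl)
    · have hlt : ∑ x ∈ S, |(b x + if x = p then -1 else 0) + if x = q then 1 else 0| <
          ∑ x ∈ S, |b x| := by
        refine Finset.sum_lt_sum (fun x hx => ?_) ⟨p, hp, ?_⟩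
        · by_cases hxp : x = p
          · subst hxp
            simp only [hpq, if_true, if_false, add_zero]
            rw [abs_of_pos hbp, abs_of_nonneg (by omega)]; omega
          · by_cases hxq : x = q
            · subst hxq
              simp only [hxp, if_true, if_false, add_zero]
              rw [abs_of_neg hbq, abs_of_nonpos (by omega)]; omega
            · simp [hxp, hxq]
        · simp only [hpq, if_true, if_false, add_zero]
          rw [abs_of_pos hbp, abs_of_nonneg (by omega)]; omega
      have h0 : 0 ≤ ∑ x ∈ S, |(b x + if x = p then -1 else 0) + if x = q then 1 else 0| :=
        Finset.sum_nonneg fun _ _ => abs_nonneg _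
      omega
    · by_cases h1 : b p = 1
      · exact Or.inl ⟨p, hp, by simp [h1, hpq]⟩
      · by_cases h2 : b q = -1
        · exact Or.inl ⟨q, hq, by simp [h2, Ne.symm hpq]⟩
        · refine Or.inr ⟨⟨p, hp, ?_⟩, ⟨q, hq, ?_⟩⟩
          · simp only [hpq, if_true, if_false]; omega
          · simp only [Ne.symm hpq, if_true, if_false]; omega

lemma Extendable.change_at (H : Extendable k S m r h b u) (hz : ∀ x ∈ S, b x ≠ 0) {v : α}
    (hv : v ∈ S) {c d e : ℤ} (u' : α) (hnet : |h v + d| ≤ r v + c) (hcd : 2 ∣ c - d)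
    (hbe : |b v + e| ≤ k) (hce : 2 ∣ c - e) (hde : 2 * k ∣ e - d)
    (hsum : ∑ x ∈ S, r x + c ≤ 2 * k - 2 + distMul k (∑ x ∈ S, b x + e))
    (hcut : ∀ A ⊂ S, v ∈ A → (A = {u'} → u' = v → b v + e ≠ 0) →
      2 * k - 2 + distMul k (∑ x ∈ A, b x + e) ≤ cutSum S m r A + c) :
    Extendable k S m (fun x => r x + if x = v then c else 0)
      (fun x => h x + if x = v then d else 0) (fun x => b x + if x = v then e else 0) u' := by
  refine ⟨H.symm, H.nonneg, fun x hx => ?_, fun x hx => ?_, fun x hx => ?_, fun x hx => ?_, ?_, ?_,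
    fun A hA hne hu => ?_⟩
  · have := H.abs_net_le x hx
    by_cases hxv : x = v
    · subst hxv; simpa using hnet
    · simpa [hxv] using this
  · have := H.net_parity x hx
    split_ifs <;> omega
  · have := H.abs_target_le x hx
    by_cases hxv : x = v
    · subst hxv; simpa using hbe
    · simpa [hxv] using this
  · rw [cutSum_add_single]
    have := H.parity x hx
    simp only [mem_singleton, eq_comm (a := v)]
    split_ifs <;> omega
  · rw [sum_add_single, sum_add_single, if_pos hv, if_pos hv]
    exact (dvd_add H.sum_dvd hde).trans (dvd_of_eq (by ring))
  · rw [sum_add_single, sum_add_single, if_pos hv, if_pos hv]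
    exact hsum
  · rw [sum_add_single, cutSum_add_single]
    by_cases hvA : v ∈ A
    · rw [if_pos hvA, if_pos hvA]
      refine hcut A hA hvA fun h1 h2 => ?_
      have := hu h1
      subst h2
      simpa using this
    · rw [if_neg hvA, if_neg hvA, add_zero, add_zero]
      exact H.le_cut A hA hne fun h => hz u (hA.1 (h ▸ mem_singleton_self u))

/-- An edge directed to the outer vertex can be dropped together with one unit of target. When none
is left, edges to the outer vertex are added at one vertex to make its target zero or negative. -/
lemma Extendable.hasOrientation_of_nonneg (hk : 0 < k) (H : Extendable k S m r h b u)
    (hS : 2 ≤ #S) (hb : ∀ x ∈ S, 0 ≤ b x)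
    (ih : ∀ (S' : Finset α) (m' : α → α → ℤ) (r' h' b' : α → ℤ) (u' : α), #S' < #S →
      Extendable k S' m' r' h' b' u' → HasOrientation k S' m' h' b') :
    HasOrientation k S m h b := by
  induction hn : (∑ x ∈ S, b x).toNat using Nat.strong_induction_on generalizing r h b with
  | _ n IH =>
    subst hn
    by_cases hz : ∃ x ∈ S, b x = 0
    · obtain ⟨v, hv, hbv⟩ := hz
      exact H.hasOrientation_of_zero hk hS hv hbv ih
    push Not at hz
    have hpos : ∀ x ∈ S, 0 < b x := fun x hx => lt_of_le_of_ne (hb x hx) (hz x hx).symm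
    have hbk : ∀ x ∈ S, b x ≤ k := fun x hx => (le_abs_self _).trans (H.abs_target_le x hx)
    rcases H.hasOrientation_or_slack hk ih with hdone | slack
    · exact hdone
    have hlecut : ∀ A ⊂ S, A.Nonempty → 2 * k - 2 + distMul k (∑ x ∈ A, b x) ≤ cutSum S m r A :=
      fun A hA hne => H.le_cut A hA hne fun h => hz u (hA.1 (h ▸ mem_singleton_self u))
    by_cases hin : ∃ v ∈ S, -r v < h v
    · obtain ⟨v, hv, hlt⟩ := hin
      have hbv := hpos v hv
      have hbvk := hbk v hv
      have habs : |b v + -1| ≤ k := abs_le.2 (by omega)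
      have H' := H.change_at hz hv (c := -1) (d := -1) (e := -1) u ?_ (by simp) habs (by simp)
        (by simp) ?_ fun A hA hvA _ => ?_
      · refine HasOrientation.of_change (v := v) (d := -1) (e := -1) hk (by simp) (hz v hv)
          (H.abs_target_le v hv) (fun t _ ht => ?_) (IH _ ?_ H' (fun x hx => ?_) rfl)
        · rw [abs_lt] at ht
          rw [abs_le]; omega
        · rw [sum_add_single, if_pos hv]
          have := Finset.single_le_sum hb hv
          omega
        · have := hpos x hx
          split_ifs <;> omega
      · have h1 := H.abs_net_le v hv
        have h2 := H.net_parity v hv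
        rw [_root_.abs_le] at h1 ⊢
        omega
      · have h1 := H.sum_le
        have h2 := distMul_le_add_abs hk (∑ x ∈ S, b x) (∑ x ∈ S, b x + -1)
        rw [show ∑ x ∈ S, b x - (∑ x ∈ S, b x + -1) = 1 by ring, abs_one] at h2
        omega
      · rcases Nat.lt_or_ge 1 #A with hcard | hcard
        · have h1 := slack A hA hcard
          have h2 := distMul_le_add_abs hk (∑ x ∈ A, b x + -1) (∑ x ∈ A, b x)
          rw [show ∑ x ∈ A, b x + -1 - ∑ x ∈ A, b x = -1 by ring, abs_neg, abs_one] at h2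
          omega
        · obtain rfl : A = {v} := Finset.eq_singleton_iff_unique_mem.2
            ⟨hvA, fun y hy => Finset.card_le_one.1 hcard y hy v hvA⟩
          have h1 := hlecut {v} hA (singleton_nonempty v)
          rw [Finset.sum_singleton] at h1 ⊢
          rw [distMul_eq_abs hk habs, abs_of_nonneg (by omega)]
          rw [distMul_eq_abs hk (H.abs_target_le v hv), abs_of_pos hbv] at h1
          omega
    push Not at hin
    have hh : ∀ x ∈ S, h x = -r x := fun x hx =>
      le_antisymm (hin x hx) (_root_.abs_le.1 (H.abs_net_le x hx)).1
    obtain ⟨v, hv⟩ : S.Nonempty := Finset.card_pos.1 (by omega)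
    have hbv := hpos v hv
    have hbvk := hbk v hv
    set d := ∑ x ∈ S, r x with hd
    have hd0 : 0 ≤ d := Finset.sum_nonneg fun x hx => (abs_nonneg _).trans (H.abs_net_le x hx)
    have hrv : |h v| ≤ r v := H.abs_net_le v hv
    have hbd : 2 * k ∣ ∑ x ∈ S, b x + d := by
      have := H.sum_dvd
      rw [Finset.sum_congr rfl hh, Finset.sum_neg_distrib, sub_neg_eq_add] at this
      exact this
    -- The total target is congruent to `-d`. If `d ≥ 2k`, its distance would be at most `d - 2k`,
    -- contradicting `sum_le`.
    have hd2k : d ≤ 2 * k - 1 := by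
      by_contra hcon
      have h1 : 2 * k ∣ ∑ x ∈ S, b x - -d := by simpa using hbd
      have h2 := H.sum_le
      rw [distMul_congr h1, distMul_neg hk] at h2
      have h3 := distMul_le_abs_sub hk d 1
      rw [mul_one, abs_of_nonneg (by omega)] at h3
      omega
    have hlip : ∀ (A : Finset α) (e c : ℤ), 2 * k ∣ e - c →
        distMul k (∑ x ∈ A, b x + e) ≤ distMul k (∑ x ∈ A, b x) + |c| := by
      intro A e c hec
      rw [distMul_congr (x := ∑ x ∈ A, b x + e) (y := ∑ x ∈ A, b x + c)
        (hec.trans (dvd_of_eq (by ring)))]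
      have := distMul_le_add_abs hk (∑ x ∈ A, b x + c) (∑ x ∈ A, b x)
      rwa [add_sub_cancel_left] at this
    -- Adding `b v` edges into `v` makes its target 0, hence `v` exempt. The outer degree bound then
    -- reads `d + b v ≤ 2k - 2 + distMul k (d + b v)`, which holds up to `2k - 1` and fails at `2k`.
    by_cases hdb : d + b v ≤ 2 * k - 1
    · have H' := H.change_at hz hv (c := b v) (d := -b v) (e := -b v) v ?_ ⟨b v, by ring⟩
        (by simpa using hk.le) ⟨b v, by ring⟩ (by simp) ?_ fun A hA hvA hAv => ?_
      · refine HasOrientation.of_change (v := v) (d := -b v) (e := -b v) hk (by simp) (hz v hv)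
          (H.abs_target_le v hv) (fun t ht1 ht2 => ?_)
          (H'.hasOrientation_of_zero hk hS hv (by simp) ih)
        rw [add_neg_cancel, sub_zero] at ht1
        rw [Int.eq_zero_of_abs_lt_dvd ht1 ht2, zero_sub, neg_neg, abs_of_pos hbv]
        omega
      · rw [hh v hv] at hrv ⊢
        rw [abs_neg] at hrv
        have := (abs_nonneg _).trans hrv
        rw [abs_of_nonpos (by omega)]
        omega
      · have e1 : distMul k (∑ x ∈ S, b x + -b v) = distMul k (d + b v) := by
          rw [← distMul_neg hk (d + b v)]
          exact distMul_congr (hbd.trans (dvd_of_eq (by ring)))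
        rw [e1]
        obtain ⟨j, hj⟩ := exists_distMul_eq k (d + b v) hk
        have : d + b v ≤ 2 * k - 2 + |d + b v - 2 * k * j| := by
          rcases le_or_gt j 0 with hj0 | hj0
          · have h1 : 2 * k * j ≤ 0 := mul_nonpos_of_nonneg_of_nonpos (by omega) hj0
            have h2 := le_abs_self (d + b v - 2 * k * j)
            omega
          · have h1 : 2 * k * 1 ≤ 2 * k * j := mul_le_mul_of_nonneg_left hj0 (by omega)
            have h2 := neg_le_abs (d + b v - 2 * k * j)
            omega
        omega
      · rcases Nat.lt_or_ge 1 #A with hcard | hcard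
        · have h1 := slack A hA hcard
          have h2 := hlip A (-b v) (-b v) (by simp)
          rw [abs_neg, abs_of_pos hbv] at h2
          omega
        · obtain rfl : A = {v} := Finset.eq_singleton_iff_unique_mem.2
            ⟨hvA, fun y hy => Finset.card_le_one.1 hcard y hy v hvA⟩
          exact absurd (add_neg_cancel (b v)) (hAv rfl rfl)
    -- Adding `k - b v` edges out of `v` raises its target to `k`, which is replaced by the
    -- congruent `-k`. The other targets stay positive, so the mixed case applies.
    · have H' := H.change_at hz hv (c := k - b v) (d := k - b v) (e := -k - b v) u ?_ (by simp)
        ?_ ⟨k, by ring⟩ ⟨-1, by ring⟩ ?_ fun A hA hvA _ => ?_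
      · refine HasOrientation.of_change (v := v) (d := k - b v) (e := -k - b v) hk ⟨-1, by ring⟩
          (hz v hv) (H.abs_target_le v hv) (fun t ht1 ht2 => ?_)
          (H'.hasOrientation_of_mixed hk hS (Or.inr ⟨?_, v, hv, ?_⟩) ih)
        · have h1 : 2 * k ∣ t - k := (ht1.add ⟨-1, rfl⟩).trans (dvd_of_eq (by ring))
          have h2 : t - k = 0 ∨ t - k ≤ -(2 * k) := by
            obtain ⟨j, hj⟩ := h1
            rw [abs_lt] at ht2
            rcases lt_trichotomy j 0 with hj0 | rfl | hj0
            · right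
              have : 2 * k * j ≤ 2 * k * (-1) := mul_le_mul_of_nonneg_left (by omega) (by omega)
              omega
            · left; simpa using hj
            · have : 2 * k * 1 ≤ 2 * k * j := mul_le_mul_of_nonneg_left hj0 (by omega)
              omega
          rw [abs_lt] at ht2
          rw [_root_.abs_le]
          rcases h2 with h2 | h2
          · omega
          · have h3 : t + k = 0 := by
              refine Int.eq_zero_of_abs_lt_dvd (m := 2 * k)
                ((h1.add ⟨1, rfl⟩).trans (dvd_of_eq (by ring))) (abs_lt.2 (by omega))
            omega
        · obtain ⟨w, hw, hwv⟩ := Finset.exists_mem_ne (by omega : 1 < #S) v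
          exact ⟨w, hw, by simpa [hwv] using hpos w hw⟩
        · simpa using hk
      · have := abs_add_le (h v) (k - b v)
        rw [abs_of_nonneg (show 0 ≤ k - b v by omega)] at this
        omega
      · rw [show b v + (-k - b v) = -k by ring, abs_neg, abs_of_pos hk]
      · have e1 : distMul k (∑ x ∈ S, b x + (-k - b v)) = distMul k (d + b v - k) := by
          rw [← distMul_neg hk (d + b v - k)]
          exact distMul_congr ((hbd.add ⟨-1, rfl⟩).trans (dvd_of_eq (by ring)))
        rw [e1]
        obtain ⟨j, hj⟩ := exists_distMul_eq k (d + b v - k) hk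
        have : d + (k - b v) ≤ 2 * k - 2 + |d + b v - k - 2 * k * j| := by
          rcases le_or_gt j 0 with hj0 | hj0
          · have h1 : 2 * k * j ≤ 0 := mul_nonpos_of_nonneg_of_nonpos (by omega) hj0
            have h2 := le_abs_self (d + b v - k - 2 * k * j)
            omega
          · have h1 : 2 * k * 1 ≤ 2 * k * j := mul_le_mul_of_nonneg_left hj0 (by omega)
            have h2 := neg_le_abs (d + b v - k - 2 * k * j)
            omega
        omega
      · have h1 := hlecut A hA ⟨v, hvA⟩
        have h2 := hlip A (-k - b v) (k - b v) ⟨-1, by ring⟩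
        rw [abs_of_nonneg (show 0 ≤ k - b v by omega)] at h2
        omega

/-- The preorientation of an extendable configuration extends to an orientation. -/
theorem Extendable.hasOrientation (hk : 0 < k) (H : Extendable k S m r h b u) :
    HasOrientation k S m h b := by
  induction hn : #S using Nat.strong_induction_on generalizing S m r h b u with
  | _ n IH =>
    subst hn
    have ih : ∀ (S' : Finset α) (m' : α → α → ℤ) (r' h' b' : α → ℤ) (u' : α), #S' < #S →
        Extendable k S' m' r' h' b' u' → HasOrientation k S' m' h' b' :=
      fun S' m' r' h' b' u' hlt H' => IH _ hlt H' rfl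
    rcases Nat.lt_or_ge 1 #S with hS | hS
    · by_cases h1 : ∀ x ∈ S, 0 ≤ b x
      · exact H.hasOrientation_of_nonneg hk hS h1 ih
      by_cases h2 : ∀ x ∈ S, b x ≤ 0
      · exact HasOrientation.of_neg ((H.neg hk).hasOrientation_of_nonneg hk hS
          (fun x hx => by have := h2 x hx; omega) ih)
      push Not at h1 h2
      exact H.hasOrientation_of_mixed hk hS (Or.inr ⟨h2, h1⟩) ih
    · exact H.hasOrientation_of_card_le_one hk hS

end Orientation

/-! ### Orientations with additional bidirected edges. -/

section Signed

variable {α β : Type*} [DecidableEq α] {k : ℤ} {S A : Finset α} {m : α → α → ℤ}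
  {N : Finset β} {inc : β → α → ℤ} {c : α → ℤ}

/-- A highly connected multigraph with multiplicities `m` on `S`, together with a set `N` of
bidirected edges that contribute the same sign to both ends, and a window `{c x, c x + 2 * k}` for
the imbalance at each vertex `x`. -/
structure SignedTarget (k : ℤ) (S : Finset α) (m : α → α → ℤ) (N : Finset β) (inc : β → α → ℤ)
    (c : α → ℤ) : Prop where
  symm : ∀ x y, m x y = m y x
  nonneg : ∀ x ∈ S, ∀ y ∈ S, x ≠ y → 0 ≤ m x y
  le_cut : ∀ A ⊂ S, A.Nonempty → 3 * k - 3 ≤ cutSum S m (fun _ => 0) A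
  exists_ends : ∀ e ∈ N, ∃ y ∈ S, ∃ z ∈ S, ∀ x,
    inc e x = (if x = y then 1 else 0) + if x = z then 1 else 0
  le_target : ∀ x ∈ S, -(2 * k) ≤ c x
  target_le : ∀ x ∈ S, c x ≤ 0
  parity : ∀ x ∈ S, 2 ∣ cutSum S m (fun _ => 0) {x} + ∑ e ∈ N, inc e x - c x
  exists_net : ∃ T : ℤ, |T| ≤ #N ∧ 2 ∣ #N - T ∧ 2 * k ∣ ∑ x ∈ S, c x - 2 * T
  compatible : k ≤ #N → ∀ e ∈ N, ∀ x, 0 < inc e x → ∀ y, 0 < inc e y → c x = 0 →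
    c y ≠ -(2 * k)

/-- There are signs of the bidirected edges and an orientation of the other edges with imbalances
in the windows. -/
def HasSigning (k : ℤ) (S : Finset α) (m : α → α → ℤ) (N : Finset β) (inc : β → α → ℤ)
    (c : α → ℤ) : Prop :=
  ∃ (ε : β → ℤ) (o : α → α → ℤ), (∀ e, ε e = 1 ∨ ε e = -1) ∧ (∀ x y, o x y = -o y x) ∧
    (∀ x ∈ S, ∀ y ∈ S, x ≠ y → |o x y| ≤ m x y ∧ 2 ∣ m x y - o x y) ∧
    ∀ x ∈ S, ∑ y ∈ S, o x y + ∑ e ∈ N, ε e * inc e x = c x ∨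
      ∑ y ∈ S, o x y + ∑ e ∈ N, ε e * inc e x = c x + 2 * k

lemma exists_signs (N : Finset β) (T : ℤ) (hT : |T| ≤ #N) (hT2 : 2 ∣ #N - T) :
    ∃ ε : β → ℤ, (∀ e, ε e = 1 ∨ ε e = -1) ∧ ∑ e ∈ N, ε e = T := by
  classical
  obtain ⟨f, hf, hsum⟩ := exists_sum_eq_of_abs_le N (fun _ => 1) (by simp) T (by simpa using hT)
    (by simpa using hT2)
  refine ⟨fun e => if e ∈ N then f e else 1, fun e => ?_, ?_⟩
  · by_cases he : e ∈ N
    · have := hf e he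
      rw [abs_le] at this
      simp only [he, if_true]
      omega
    · simp [he]
  · rw [← hsum]
    exact Finset.sum_congr rfl fun e he => if_pos he

lemma cutSum_eq_add (r : α → ℤ) :
    cutSum S m r A = cutSum S m (fun _ => 0) A + ∑ x ∈ A, r x := by
  simp [cutSum, Finset.sum_add_distrib]

/-- A representative with `|T'| ≤ k` can exceed `n` only if `n = k - 1` and `|T'| = k`, which parity
excludes. Thus a total sign is available for every residue of the right parity as long as `k - 1`
bidirected edges remain. -/
lemma exists_abs_le_of_parity (hk : 0 < k) {n T : ℤ} (hn : k - 1 ≤ n) (hT : 2 ∣ n - T) :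
    ∃ T', |T'| ≤ n ∧ 2 ∣ n - T' ∧ 2 * k ∣ T - T' := by
  obtain ⟨T', h1, h2⟩ := exists_abs_le_dvd_sub hk T
  have h3 := two_dvd_of_two_mul_dvd h2
  refine ⟨T', ?_, by omega, h2⟩
  rw [abs_le] at h1 ⊢
  omega

lemma SignedTarget.sum_inc (H : SignedTarget k S m N inc c) {e : β} (he : e ∈ N) :
    ∑ x ∈ S, inc e x = 2 := by
  obtain ⟨y, hy, z, hz, h⟩ := H.exists_ends e he
  simp only [h, Finset.sum_add_distrib, Finset.sum_ite_eq', hy, hz, if_true]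
  rfl

lemma SignedTarget.inc_nonneg (H : SignedTarget k S m N inc c) {e : β} (he : e ∈ N) (x : α) :
    0 ≤ inc e x := by
  obtain ⟨y, hy, z, hz, h⟩ := H.exists_ends e he
  rw [h]; split_ifs <;> omega

lemma SignedTarget.exists_end (H : SignedTarget k S m N inc c) {e : β} (he : e ∈ N) {v : α}
    (hv : 0 < inc e v) :
    ∃ y ∈ S, ∀ x, inc e x = (if x = v then 1 else 0) + if x = y then 1 else 0 := by
  obtain ⟨y, hy, z, hz, h⟩ := H.exists_ends e he
  rw [h] at hv
  by_cases hvy : v = y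
  · exact ⟨z, hz, hvy ▸ h⟩
  · by_cases hvz : v = z
    · exact ⟨y, hy, fun x => by rw [h, hvz, add_comm]⟩
    · simp [hvy, hvz] at hv

/-- Few bidirected edges can be preoriented all at once. -/
lemma SignedTarget.hasSigning_of_card_lt (hk : 0 < k) (H : SignedTarget k S m N inc c)
    (hN : (#N : ℤ) ≤ k - 1) : HasSigning k S m N inc c := by
  obtain ⟨T, hT1, hT2, hT3⟩ := H.exists_net
  obtain ⟨ε, hε, hsum⟩ := exists_signs N T hT1 hT2
  rcases S.eq_empty_or_nonempty with rfl | ⟨u, hu⟩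
  · exact ⟨ε, fun _ _ => 0, hε, by simp, by simp, by simp⟩
  have hrep : ∀ x, ∃ y, |y| ≤ k ∧ 2 * k ∣ c x - y := fun x => exists_abs_le_dvd_sub hk (c x)
  choose b hb hcb using hrep
  set r : α → ℤ := fun x => ∑ e ∈ N, inc e x with hr
  have hrsum : ∑ x ∈ S, r x = 2 * #N := by
    rw [Finset.sum_comm, Finset.sum_congr rfl fun e he => H.sum_inc he]
    simp [mul_comm]
  have hhsum : ∑ x ∈ S, ∑ e ∈ N, ε e * inc e x = 2 * T := by
    rw [Finset.sum_comm, ← hsum, Finset.mul_sum]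
    refine Finset.sum_congr rfl fun e he => ?_
    rw [← Finset.mul_sum, H.sum_inc he, mul_comm]
  have hpar : ∀ x ∈ S, 2 ∣ cutSum S m r {x} - b x := by
    intro x hx
    have h1 := H.parity x hx
    have h2 := two_dvd_of_two_mul_dvd (hcb x)
    rw [cutSum_eq_add, Finset.sum_singleton, hr]
    beta_reduce
    omega
  have hbc : ∀ A : Finset α, 2 * k ∣ ∑ x ∈ A, c x - ∑ x ∈ A, b x := fun A => by
    rw [← Finset.sum_sub_distrib]
    exact Finset.dvd_sum fun x _ => hcb x
  have hX : Extendable k S m r (fun x => ∑ e ∈ N, ε e * inc e x) b u := by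
    refine ⟨H.symm, H.nonneg, fun x hx => ?_, fun x hx => ?_, fun x _ => hb x, hpar, ?_, ?_,
      fun A hA hne _ => ?_⟩
    · refine (Finset.abs_sum_le_sum_abs _ _).trans (Finset.sum_le_sum fun e he => ?_)
      have := H.inc_nonneg he x
      rcases hε e with h | h <;> simp [h, abs_of_nonneg this]
    · rw [hr, ← Finset.sum_sub_distrib]
      refine Finset.dvd_sum fun e _ => ?_
      rcases hε e with h | h <;> rw [h] <;> omega
    · rw [hhsum]
      exact (dvd_sub hT3 (hbc S)).trans (dvd_of_eq (by ring))
    · rw [hrsum]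
      have := distMul_nonneg hk (∑ x ∈ S, b x)
      omega
    -- The bound `3k - 3` suffices unless the distance is `k`; then the cut has the parity of `k`,
    -- hence has at least `3k - 2` edges.
    · have h1 := H.le_cut A hA hne
      have h2 : 0 ≤ ∑ x ∈ A, r x :=
        Finset.sum_nonneg fun x _ => Finset.sum_nonneg fun e he => H.inc_nonneg he x
      have h3 := two_dvd_cutSum_sub_sum (r := r) H.symm hA.1
      have h4 : (2 : ℤ) ∣ ∑ x ∈ A, (cutSum S m r {x} - b x) :=
        Finset.dvd_sum fun x hx => hpar x (hA.1 hx)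
      rw [Finset.sum_sub_distrib] at h4
      have h5 := two_dvd_distMul_sub hk (∑ x ∈ A, b x)
      have h6 := distMul_le k (∑ x ∈ A, b x)
      have h7 := cutSum_eq_add (S := S) (A := A) (m := m) r
      omega
  obtain ⟨o, ho1, ho2, ho3⟩ := hX.hasOrientation hk
  refine ⟨ε, o, hε, ho1, ho2, fun x hx => ?_⟩
  obtain ⟨h1, h2⟩ := ho3 x hx
  beta_reduce at h1 h2
  -- The imbalance is `c x + 2kj` with absolute value below `2k`; as `-2k ≤ c x ≤ 0`, only `j = 0`
  -- and `j = 1` are possible.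
  obtain ⟨j, hj⟩ := dvd_sub h1 (hcb x)
  have hc1 := H.le_target x hx
  have hc2 := H.target_le x hx
  rw [abs_lt] at h2
  rcases lt_trichotomy j 0 with hj0 | rfl | hj0
  · have : 2 * k * j ≤ 2 * k * (-1) := mul_le_mul_of_nonneg_left (by omega) (by omega)
    omega
  · omega
  · rcases eq_or_lt_of_le (show 1 ≤ j from hj0) with rfl | hj1
    · omega
    · have : 2 * k * 2 ≤ 2 * k * j := mul_le_mul_of_nonneg_left (by omega) (by omega)
      omega

variable [DecidableEq β]

/-- Two bidirected edges with a common end can be replaced by one ordinary edge. -/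
lemma SignedTarget.pair (hk : 0 < k) (H : SignedTarget k S m N inc c) {e f : β} (he : e ∈ N)
    (hf : f ∈ N) (hef : e ≠ f) {v y z : α} (hy : y ∈ S) (hz : z ∈ S)
    (hey : ∀ x, inc e x = (if x = v then 1 else 0) + if x = y then 1 else 0)
    (hfz : ∀ x, inc f x = (if x = v then 1 else 0) + if x = z then 1 else 0)
    (hN : k + 1 ≤ #N) :
    SignedTarget k S (fun x w => m x w + 1 * edgeAt y z x w) ((N.erase e).erase f) inc c := by
  have hfe : f ∈ N.erase e := mem_erase.2 ⟨hef.symm, hf⟩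
  have hcard : (#((N.erase e).erase f) : ℤ) = #N - 2 := by
    have h1 := Finset.card_erase_add_one hfe
    have h2 := Finset.card_erase_add_one he
    omega
  have hsub : (N.erase e).erase f ⊆ N := (erase_subset _ _).trans (erase_subset _ _)
  refine ⟨fun x w => ?_, fun x hx w hw hxw => ?_, fun A hA hne => ?_,
    fun g hg => H.exists_ends g (hsub hg), H.le_target, H.target_le, fun x hx => ?_, ?_,
    fun _ g hg => H.compatible (by omega) g (hsub hg)⟩
  · rw [H.symm x w, edgeAt_comm]
  · have h1 := H.nonneg x hx w hw hxw
    have h2 : 0 ≤ edgeAt y z x w := by unfold edgeAt; split_ifs <;> omega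
    omega
  · rw [cutSum_add_edgeAt hy hz]
    have := H.le_cut A hA hne
    have := crossAt_nonneg y z A
    omega
  · rw [cutSum_add_edgeAt hy hz]
    have h1 := H.parity x hx
    have h2 := Finset.add_sum_erase N (fun g => inc g x) he
    have h3 := Finset.add_sum_erase (N.erase e) (fun g => inc g x) hfe
    beta_reduce at h2 h3
    rw [hey] at h2
    rw [hfz] at h3
    unfold crossAt
    simp only [mem_singleton, eq_comm (a := y), eq_comm (a := z)]
    by_cases hxy : x = y <;> by_cases hxz : x = z <;> simp only [hxy, hxz] at h1 h2 h3 ⊢ <;>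
      split_ifs at h2 h3 ⊢ <;> simp_all <;> omega
  · obtain ⟨T, hT1, hT2, hT3⟩ := H.exists_net
    rw [hcard]
    obtain ⟨T', h1, h2, h3⟩ := exists_abs_le_of_parity (n := #N - 2) (T := T) hk (by omega)
      (by omega)
    refine ⟨T', h1, h2, ?_⟩
    exact (hT3.add (h3.mul_left 2)).trans (dvd_of_eq (by ring))

/-- The edges `e` and `f` receive opposite signs, which cancel at the common end `v` and leave the
contribution of an edge between `y` and `z`. The case `y = z` is allowed: the new edge is then a
loop and contributes nothing. -/
lemma HasSigning.of_pair {e f : β} (he : e ∈ N)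
    (hf : f ∈ N) (hef : e ≠ f) {v y z : α} (hy : y ∈ S) (hz : z ∈ S)
    (hey : ∀ x, inc e x = (if x = v then 1 else 0) + if x = y then 1 else 0)
    (hfz : ∀ x, inc f x = (if x = v then 1 else 0) + if x = z then 1 else 0)
    (hsymm : ∀ x y, m x y = m y x) (hm : y ≠ z → 0 ≤ m y z)
    (H : HasSigning k S (fun x w => m x w + 1 * edgeAt y z x w) ((N.erase e).erase f) inc c) :
    HasSigning k S m N inc c := by
  obtain ⟨ε, o, hε, ho1, ho2, ho3⟩ := H
  obtain ⟨s, hs, hs'⟩ : ∃ s : ℤ, (s = 1 ∨ s = -1) ∧ (y ≠ z → |o y z - s| ≤ m y z) := by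
    by_cases hyz : y = z
    · exact ⟨1, Or.inl rfl, fun h => absurd hyz h⟩
    · have h0 := hm hyz
      have := ho2 y hy z hz hyz
      beta_reduce at this
      have e3 : edgeAt y z y z = 1 := by simp [edgeAt, hyz]
      rw [e3, abs_le] at this
      by_cases h0 : 0 ≤ o y z
      · exact ⟨1, Or.inl rfl, fun _ => abs_le.2 (by omega)⟩
      · exact ⟨-1, Or.inr rfl, fun _ => abs_le.2 (by omega)⟩
  refine ⟨fun g => if g = e then s else if g = f then -s else ε g,
    fun x w => o x w - s * arcAt y z x w, fun g => ?_, fun x w => ?_, fun x hx w hw hxw => ?_,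
    fun x hx => ?_⟩
  · have := hε g
    beta_reduce
    rcases hs with rfl | rfl <;> split_ifs <;> omega
  · beta_reduce
    rw [ho1 x w, arcAt_antisymm y z]; ring
  · have h1 := ho2 x hx w hw hxw
    beta_reduce at h1 ⊢
    by_cases hyz : y = z
    · have e1 : edgeAt y z x w = 0 := by
        subst hyz; unfold edgeAt; rw [if_neg, zero_add] <;> rintro ⟨rfl, rfl⟩ <;> exact hxw rfl
      have e2 : arcAt y z x w = 0 := by subst hyz; simp [arcAt]
      rw [e1] at h1
      rw [e2]
      simpa using h1
    · have h2 := hs' hyz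
      have h3 := hsymm y z
      have h4 := ho1 y z
      rw [abs_le] at h1 h2 ⊢
      rcases edgeAt_arcAt_cases hyz x w with ⟨p3, p4, p1, p2⟩ | ⟨p3, p4, p1, p2⟩ | ⟨p1, p2, -⟩ <;>
      simp only [p1, p2] at h1 ⊢ <;> subst_vars <;> rcases hs with rfl | rfl <;> omega
  · have hfe : f ∈ N.erase e := mem_erase.2 ⟨hef.symm, hf⟩
    rw [← Finset.add_sum_erase N _ he, ← Finset.add_sum_erase (N.erase e) _ hfe,
      Finset.sum_sub_distrib, ← Finset.mul_sum, sum_arcAt hy hz]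
    have e1 : ∑ g ∈ (N.erase e).erase f, (if g = e then s else if g = f then -s else ε g) * inc g x =
        ∑ g ∈ (N.erase e).erase f, ε g * inc g x := by
      refine Finset.sum_congr rfl fun g hg => ?_
      rw [mem_erase, mem_erase] at hg
      rw [if_neg hg.2.1, if_neg hg.1]
    beta_reduce
    rw [e1, if_pos rfl, if_neg hef.symm, if_pos rfl, hey, hfz]
    have := ho3 x hx
    have e2 : ∑ w ∈ S, o x w - s * ((if x = y then 1 else 0) - if x = z then 1 else 0) +
        (s * ((if x = v then 1 else 0) + if x = y then 1 else 0) +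
        (-s * ((if x = v then 1 else 0) + if x = z then 1 else 0) +
          ∑ g ∈ (N.erase e).erase f, ε g * inc g x)) =
        ∑ w ∈ S, o x w + ∑ g ∈ (N.erase e).erase f, ε g * inc g x := by ring
    rw [e2]
    exact this

/-- Fixing the sign of one bidirected edge. -/
lemma SignedTarget.absorb (hk : 0 < k) (H : SignedTarget k S m N inc c) {e : β} (he : e ∈ N)
    {s : ℤ} (hs : s = 1 ∨ s = -1) (hN : k ≤ #N)
    (hrange : ∀ x ∈ S, -(2 * k) ≤ c x - s * inc e x ∧ c x - s * inc e x ≤ 0)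
    (hcomp : k + 1 ≤ #N → ∀ f ∈ N, f ≠ e → ∀ x, 0 < inc f x → ∀ y, 0 < inc f y →
      c x - s * inc e x = 0 → c y - s * inc e y ≠ -(2 * k)) :
    SignedTarget k S m (N.erase e) inc (fun x => c x - s * inc e x) := by
  have hcard : (#(N.erase e) : ℤ) = #N - 1 := by
    have h2 := Finset.card_erase_add_one he
    omega
  refine ⟨H.symm, H.nonneg, H.le_cut, fun g hg => H.exists_ends g (mem_of_mem_erase hg),
    fun x hx => (hrange x hx).1, fun x hx => (hrange x hx).2, fun x hx => ?_, ?_,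
    fun h g hg => hcomp (by omega) g (mem_of_mem_erase hg) (ne_of_mem_erase hg)⟩
  · have h1 := H.parity x hx
    have h2 := Finset.add_sum_erase N (fun g => inc g x) he
    beta_reduce at h2
    rcases hs with rfl | rfl <;> omega
  · obtain ⟨T, hT1, hT2, hT3⟩ := H.exists_net
    rw [hcard]
    obtain ⟨T', h1, h2, h3⟩ := exists_abs_le_of_parity (n := #N - 1) (T := T - s) hk (by omega)
      (by omega)
    refine ⟨T', h1, h2, ?_⟩
    rw [Finset.sum_sub_distrib, ← Finset.mul_sum, H.sum_inc he]
    exact (hT3.add (h3.mul_left 2)).trans (dvd_of_eq (by ring))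

lemma HasSigning.of_absorb {e : β} (he : e ∈ N) {s : ℤ} (hs : s = 1 ∨ s = -1)
    (H : HasSigning k S m (N.erase e) inc (fun x => c x - s * inc e x)) :
    HasSigning k S m N inc c := by
  obtain ⟨ε, o, hε, ho1, ho2, ho3⟩ := H
  refine ⟨fun g => if g = e then s else ε g, o, fun g => ?_, ho1, ho2, fun x hx => ?_⟩
  · have := hε g
    beta_reduce
    split_ifs <;> assumption
  · rw [← Finset.add_sum_erase N _ he]
    have e1 : ∑ g ∈ N.erase e, (if g = e then s else ε g) * inc g x =
        ∑ g ∈ N.erase e, ε g * inc g x :=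
      Finset.sum_congr rfl fun g hg => by rw [if_neg (ne_of_mem_erase hg)]
    beta_reduce
    rw [e1, if_pos rfl]
    have := ho3 x hx
    beta_reduce at this
    omega

/-- A loop together with an ordinary edge at the same vertex is absorbed when `k = 1`. -/
lemma SignedTarget.absorbLoop (H : SignedTarget 1 S m N inc c) {e : β} (he : e ∈ N)
    {s : ℤ} (hs : s = 1 ∨ s = -1) {v w : α} (hv : v ∈ S) (hw : w ∈ S) (hvw : v ≠ w)
    (hm : 0 < m v w) (hev : ∀ x, inc e x = 2 * if x = v then 1 else 0)
    (hrange : ∀ x ∈ S, -2 ≤ c x - s * ((if x = v then 1 else 0) + if x = w then 1 else 0) ∧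
      c x - s * ((if x = v then 1 else 0) + if x = w then 1 else 0) ≤ 0)
    (hloop : ∀ f ∈ N, ∀ x, 0 < inc f x → ∀ y, 0 < inc f y → x = y) :
    SignedTarget 1 S (fun x z => m x z + -1 * edgeAt v w x z) (N.erase e) inc
      (fun x => c x - s * ((if x = v then 1 else 0) + if x = w then 1 else 0)) := by
  have hcard : (#(N.erase e) : ℤ) = #N - 1 := by
    have h2 := Finset.card_erase_add_one he
    omega
  have hnn : ∀ x ∈ S, ∀ y ∈ S, x ≠ y → 0 ≤ m x y + -1 * edgeAt v w x y := by
    intro x hx z hz hxz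
    have h1 := H.nonneg x hx z hz hxz
    have h2 := H.symm v w
    rcases edgeAt_arcAt_cases hvw x z with ⟨p3, p4, p1, -⟩ | ⟨p3, p4, p1, -⟩ | ⟨p1, -⟩ <;>
    simp only [p1] <;> subst_vars <;> omega
  refine ⟨fun x z => ?_, hnn, fun A hA hne => ?_,
    fun g hg => H.exists_ends g (mem_of_mem_erase hg),
    fun x hx => (hrange x hx).1, fun x hx => (hrange x hx).2, fun x hx => ?_, ?_,
    fun _ g hg x hx y hy h1 h2 => ?_⟩
  · rw [H.symm x z, edgeAt_comm]
  -- For `k = 1` the required connectivity `3k - 3` is 0, so deleting an ordinary edge costs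
  -- nothing.
  · refine le_trans (by norm_num) (Finset.sum_nonneg fun x hx => ?_)
    rw [add_zero]
    refine Finset.sum_nonneg fun y hy => ?_
    rw [mem_sdiff] at hy
    exact hnn x (hA.1 hx) y hy.1 (ne_of_mem_of_not_mem hx hy.2)
  · rw [cutSum_add_edgeAt hv hw, crossAt_singleton hvw]
    have h1 := H.parity x hx
    have h2 := Finset.add_sum_erase N (fun g => inc g x) he
    beta_reduce at h2
    rw [hev] at h2
    split_ifs at h2 ⊢ <;> rcases hs with rfl | rfl <;> omega
  · obtain ⟨T, hT1, hT2, hT3⟩ := H.exists_net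
    have hpos : 0 < #N := Finset.card_pos.2 ⟨e, he⟩
    rw [hcard]
    obtain ⟨T', h1, h2, h3⟩ := exists_abs_le_of_parity (k := 1) (n := #N - 1) (T := T - s)
      one_pos (by omega) (by omega)
    refine ⟨T', h1, h2, ?_⟩
    rw [Finset.sum_sub_distrib, ← Finset.mul_sum, Finset.sum_add_distrib, Finset.sum_ite_eq',
      Finset.sum_ite_eq', if_pos hv, if_pos hw]
    omega
  · have := hloop g (mem_of_mem_erase hg) x hx y hy
    subst this
    omega

lemma HasSigning.of_absorbLoop {e : β} (he : e ∈ N) {s : ℤ} (hs : s = 1 ∨ s = -1) {v w : α}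
    (hv : v ∈ S) (hw : w ∈ S) (hvw : v ≠ w) (hsymm : ∀ x y, m x y = m y x)
    (hev : ∀ x, inc e x = 2 * if x = v then 1 else 0)
    (H : HasSigning k S (fun x z => m x z + -1 * edgeAt v w x z) (N.erase e) inc
      (fun x => c x - s * ((if x = v then 1 else 0) + if x = w then 1 else 0))) :
    HasSigning k S m N inc c := by
  obtain ⟨ε, o, hε, ho1, ho2, ho3⟩ := H
  refine ⟨fun g => if g = e then s else ε g, fun x z => o x z - s * arcAt v w x z, fun g => ?_,
    fun x z => ?_, fun x hx z hz hxz => ?_, fun x hx => ?_⟩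
  · have := hε g
    beta_reduce
    split_ifs <;> assumption
  · beta_reduce
    rw [ho1 x z, arcAt_antisymm v w]; ring
  · have h1 := ho2 x hx z hz hxz
    have h3 := hsymm v w
    beta_reduce at h1 ⊢
    rw [abs_le] at h1 ⊢
    rcases edgeAt_arcAt_cases hvw x z with ⟨p3, p4, p1, p2⟩ | ⟨p3, p4, p1, p2⟩ | ⟨p1, p2, -⟩ <;>
    simp only [p1, p2] at h1 ⊢ <;> rcases hs with rfl | rfl <;> omega
  · rw [← Finset.add_sum_erase N _ he, Finset.sum_sub_distrib, ← Finset.mul_sum,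
      sum_arcAt hv hw]
    have e1 : ∑ g ∈ N.erase e, (if g = e then s else ε g) * inc g x =
        ∑ g ∈ N.erase e, ε g * inc g x :=
      Finset.sum_congr rfl fun g hg => by rw [if_neg (ne_of_mem_erase hg)]
    beta_reduce
    rw [e1, if_pos rfl, hev]
    have := ho3 x hx
    beta_reduce at this
    split_ifs at this ⊢ <;> rcases hs with rfl | rfl <;> omega

/-- Pairing is preferred while more than `k` bidirected edges remain. Once it is impossible those
edges are pairwise disjoint, so signing one leaves the windows at the ends of the others alone and
preserves `compatible`. With exactly `k` edges, `compatible` is no longer required after one is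
signed. -/
theorem SignedTarget.hasSigning (hk : 0 < k) (H : SignedTarget k S m N inc c) :
    HasSigning k S m N inc c := by
  induction hn : #N using Nat.strong_induction_on generalizing N m c with
  | _ n IH =>
    subst hn
    rcases le_or_gt (#N : ℤ) (k - 1) with hlt | hge
    · exact H.hasSigning_of_card_lt hk hlt
    have hkN : k ≤ #N := by omega
    by_cases hshare : k + 1 ≤ #N ∧ ∃ e ∈ N, ∃ f ∈ N, e ≠ f ∧ ∃ v, 0 < inc e v ∧ 0 < inc f v
    · obtain ⟨hN, e, he, f, hf, hef, v, hev, hfv⟩ := hshare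
      obtain ⟨y, hy, hey⟩ := H.exists_end he hev
      obtain ⟨z, hz, hfz⟩ := H.exists_end hf hfv
      refine HasSigning.of_pair he hf hef hy hz hey hfz H.symm (fun h => H.nonneg y hy z hz h)
        (IH _ ?_ (H.pair hk he hf hef hy hz hey hfz hN) rfl)
      exact (Finset.card_le_card (erase_subset _ _)).trans_lt (Finset.card_erase_lt_of_mem he)
    have hdisj : k + 1 ≤ #N → ∀ e ∈ N, ∀ f ∈ N, e ≠ f → ∀ v, 0 < inc e v → inc f v = 0 := by
      intro hN e he f hf hef v hev
      by_contra h0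
      have := H.inc_nonneg hf v
      exact hshare ⟨hN, e, he, f, hf, hef, v, hev, by omega⟩
    by_cases hlink : ∃ e ∈ N, ∃ y ∈ S, ∃ z ∈ S, y ≠ z ∧
        ∀ x, inc e x = (if x = y then 1 else 0) + if x = z then 1 else 0
    · obtain ⟨e, he, y, hy, z, hz, hyz, hinc⟩ := hlink
      have hiy : inc e y = 1 := by rw [hinc]; simp [hyz]
      have hiz : inc e z = 1 := by rw [hinc]; simp [hyz.symm]
      have hio : ∀ x, x ≠ y → x ≠ z → inc e x = 0 := fun x h1 h2 => by rw [hinc]; simp [h1, h2]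
      obtain ⟨s, hs, hrange⟩ : ∃ s : ℤ, (s = 1 ∨ s = -1) ∧
          ∀ x ∈ S, -(2 * k) ≤ c x - s * inc e x ∧ c x - s * inc e x ≤ 0 := by
        have hyl := H.le_target y hy
        have hyu := H.target_le y hy
        have hzl := H.le_target z hz
        have hzu := H.target_le z hz
        have h1 := H.compatible hkN e he y (by omega) z (by omega)
        have h2 := H.compatible hkN e he z (by omega) y (by omega)
        have key : ∀ s : ℤ, (-(2 * k) ≤ c y - s ∧ c y - s ≤ 0) →
            (-(2 * k) ≤ c z - s ∧ c z - s ≤ 0) →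
            ∀ x ∈ S, -(2 * k) ≤ c x - s * inc e x ∧ c x - s * inc e x ≤ 0 := by
          intro s h3 h4 x hx
          by_cases hxy : x = y
          · subst hxy; rw [hiy]; omega
          · by_cases hxz : x = z
            · subst hxz; rw [hiz]; omega
            · rw [hio x hxy hxz, mul_zero, sub_zero]
              exact ⟨H.le_target x hx, H.target_le x hx⟩
        -- The sign 1 fails only where `c = -2k`, the sign -1 only where `c = 0`; `compatible`
        -- forbids both at the two ends of one edge.
        by_cases h3 : c y = -(2 * k) ∨ c z = -(2 * k)
        · refine ⟨-1, Or.inr rfl, key _ ?_ ?_⟩ <;> omega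
        · refine ⟨1, Or.inl rfl, key _ ?_ ?_⟩ <;> omega
      refine HasSigning.of_absorb he hs (IH _ (Finset.card_erase_lt_of_mem he)
        (H.absorb hk he hs hkN hrange fun hN f hf hfe x hx w hw => ?_) rfl)
      rw [hdisj hN f hf e he hfe x hx, hdisj hN f hf e he hfe w hw, mul_zero, sub_zero, sub_zero]
      exact H.compatible hkN f hf x hx w hw
    · have hloops : ∀ e ∈ N, ∃ v ∈ S, ∀ x, inc e x = 2 * if x = v then 1 else 0 := by
        intro e he
        obtain ⟨y, hy, z, hz, h⟩ := H.exists_ends e he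
        by_cases hyz : y = z
        · subst hyz
          exact ⟨y, hy, fun x => by rw [h]; ring⟩
        · exact absurd ⟨e, he, y, hy, z, hz, hyz, h⟩ hlink
      have hloop : ∀ f ∈ N, ∀ x, 0 < inc f x → ∀ y, 0 < inc f y → x = y := by
        intro f hf x hx y hy
        obtain ⟨v, -, h⟩ := hloops f hf
        rw [h] at hx hy
        by_cases hxv : x = v
        · by_cases hyv : y = v
          · rw [hxv, hyv]
          · simp [hyv] at hy
        · simp [hxv] at hx
      obtain ⟨e, he⟩ : N.Nonempty := Finset.card_pos.1 (by omega)
      obtain ⟨v, hv, hev⟩ := hloops e he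
      have hvl := H.le_target v hv
      have hvu := H.target_le v hv
      by_cases hcase : 2 ≤ k ∨ c v ≠ -1
      · obtain ⟨s, hs, hrange⟩ : ∃ s : ℤ, (s = 1 ∨ s = -1) ∧
            (-(2 * k) ≤ c v - s * 2 ∧ c v - s * 2 ≤ 0) := by
          by_cases h3 : c v ≤ -2
          · exact ⟨-1, Or.inr rfl, by omega⟩
          · exact ⟨1, Or.inl rfl, by omega⟩
        refine HasSigning.of_absorb he hs (IH _ (Finset.card_erase_lt_of_mem he)
          (H.absorb hk he hs hkN (fun x hx => ?_) fun hN f hf hfe x hx w hw h1 h2 => ?_) rfl)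
        · rw [hev]
          by_cases hxv : x = v
          · subst hxv; simpa using hrange
          · simpa [hxv] using ⟨H.le_target x hx, H.target_le x hx⟩
        · have := hloop f hf x hx w hw
          subst this
          omega
      -- The one obstruction to signing a loop: `c v = -1` with `k = 1`, where a shift by 2 either
      -- way leaves `[-2, 0]`.
      · obtain rfl : k = 1 := by omega
        have hcv : c v = -1 := by omega
        have hsum : ∑ f ∈ N, inc f v = 2 := by
          rw [← Finset.add_sum_erase N _ he, hev, if_pos rfl, Finset.sum_eq_zero fun f hf => ?_]
          · norm_num
          · rw [mem_erase] at hf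
            have hcard : 1 < #N := Finset.one_lt_card.2 ⟨f, hf.2, e, he, hf.1⟩
            exact hdisj (by omega) e he f hf.2 hf.1.symm v (by rw [hev]; simp)
        -- The loop is the only bidirected edge at `v` and `c v` is odd, so parity forces an
        -- ordinary edge `vw`. Loop and edge together contribute `s` at both `v` and `w`.
        obtain ⟨w, hw, hvw, hm⟩ : ∃ w ∈ S, v ≠ w ∧ 0 < m v w := by
          by_contra hcon
          push Not at hcon
          have h1 := H.parity v hv
          have h2 : cutSum S m (fun _ => 0) {v} = 0 := by
            unfold cutSum
            rw [Finset.sum_singleton, add_zero]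
            refine Finset.sum_eq_zero fun y hy => ?_
            rw [mem_sdiff, mem_singleton] at hy
            exact le_antisymm (hcon y hy.1 (Ne.symm hy.2)) (H.nonneg v hv y hy.1 (Ne.symm hy.2))
          omega
        have hwl := H.le_target w hw
        have hwu := H.target_le w hw
        obtain ⟨s, hs, hrange⟩ : ∃ s : ℤ, (s = 1 ∨ s = -1) ∧ -2 ≤ c w - s ∧ c w - s ≤ 0 := by
          by_cases h3 : c w = -2
          · exact ⟨-1, Or.inr rfl, by omega⟩
          · exact ⟨1, Or.inl rfl, by omega⟩
        refine HasSigning.of_absorbLoop he hs hv hw hvw H.symm hev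
          (IH _ (Finset.card_erase_lt_of_mem he)
          (H.absorbLoop he hs hv hw hvw hm hev (fun x hx => ?_) hloop) rfl)
        by_cases hxv : x = v
        · subst hxv
          simp only [if_true, hvw, if_false]
          rcases hs with rfl | rfl <;> omega
        · by_cases hxw : x = w
          · subst hxw
            simpa [hxv] using hrange
          · simpa [hxv, hxw] using ⟨H.le_target x hx, H.target_le x hx⟩

end Signed

/-! ### Maximum cuts. -/

section MaxCut

variable {α β : Type*} [DecidableEq α]

/-- A maximum cut meets every edge cut in at least half of its edges. -/
lemma exists_two_mul_card_cut_inter_ge (S : Finset α) (E : Finset β) (p q : β → α) :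
    ∃ X ⊆ S, ∀ A ⊆ S, #{e ∈ E | ¬(p e ∈ A ↔ q e ∈ A)} ≤
      2 * #{e ∈ E | ¬(p e ∈ X ↔ q e ∈ X) ∧ ¬(p e ∈ A ↔ q e ∈ A)} := by
  obtain ⟨X, hX, hmax⟩ := Finset.exists_max_image S.powerset
    (fun X => #{e ∈ E | ¬(p e ∈ X ↔ q e ∈ X)}) ⟨∅, by simp⟩
  rw [mem_powerset] at hX
  refine ⟨X, hX, fun A hA => ?_⟩
  -- Switching the side of `A` exchanges the edges leaving `A` that cross `X` with those that do
  -- not; maximality says that this gains nothing.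
  have h1 := hmax (symmDiff X A) (by
    rw [mem_powerset]
    intro x hx
    rw [Finset.mem_symmDiff] at hx
    rcases hx with hx | hx
    · exact hX hx.1
    · exact hA hx.1)
  simp only [card_filter] at h1 ⊢
  have h2 : ∑ e ∈ E, (if ¬(p e ∈ symmDiff X A ↔ q e ∈ symmDiff X A) then 1 else 0) +
      2 * ∑ e ∈ E, (if ¬(p e ∈ X ↔ q e ∈ X) ∧ ¬(p e ∈ A ↔ q e ∈ A) then 1 else 0) =
      ∑ e ∈ E, (if ¬(p e ∈ X ↔ q e ∈ X) then 1 else 0) +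
      ∑ e ∈ E, if ¬(p e ∈ A ↔ q e ∈ A) then 1 else 0 := by
    rw [mul_sum, ← sum_add_distrib, ← sum_add_distrib]
    refine sum_congr rfl fun e _ => ?_
    by_cases h1 : p e ∈ X <;> by_cases h2 : q e ∈ X <;> by_cases h3 : p e ∈ A <;>
      by_cases h4 : q e ∈ A <;> simp [Finset.mem_symmDiff, h1, h2, h3, h4]
  omega

end MaxCut

/-! ### From edge signs to oriented and bidirected edges across a cut. -/

section BipartiteCut

variable {α β : Type*} [DecidableEq α]

/-- The contribution of the edge `e` with ends `p e` and `q e` to the degree of `x`. -/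
def endCount (p q : β → α) (e : β) (x : α) : ℤ :=
  (if x = p e then 1 else 0) + if x = q e then 1 else 0

/-- The number of edges of `B` with ends `x` and `y`, for ends `p e ≠ q e`. -/
def linkCount (B : Finset β) (p q : β → α) (x y : α) : ℤ :=
  #{e ∈ B | p e = x ∧ q e = y} + #{e ∈ B | p e = y ∧ q e = x}

lemma linkCount_nonneg {B : Finset β} {p q : β → α} (x y : α) : 0 ≤ linkCount B p q x y :=
  add_nonneg (Int.natCast_nonneg _) (Int.natCast_nonneg _)

lemma sum_endCount {p q : β → α} (A : Finset α) (e : β) :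
    ∑ x ∈ A, endCount p q e x = (if p e ∈ A then 1 else 0) + if q e ∈ A then 1 else 0 := by
  simp [endCount, sum_add_distrib]

lemma cutSum_linkCount {S A : Finset α} {B : Finset β} {p q : β → α}
    (hp : ∀ e ∈ B, p e ∈ S) (hq : ∀ e ∈ B, q e ∈ S) :
    cutSum S (linkCount B p q) (fun _ => 0) A = #{e ∈ B | ¬(p e ∈ A ↔ q e ∈ A)} := by
  have hprod (u v : α) (C D : Finset α) : ∑ x ∈ C, ∑ y ∈ D,
      (if u = x ∧ v = y then (1 : ℤ) else 0) = if u ∈ C ∧ v ∈ D then 1 else 0 := by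
    simp [ite_and, sum_ite_irrel]
  have key : ∀ e ∈ B, ∑ x ∈ A, ∑ y ∈ S \ A, ((if p e = x ∧ q e = y then (1 : ℤ) else 0) +
      if p e = y ∧ q e = x then 1 else 0) = if ¬(p e ∈ A ↔ q e ∈ A) then 1 else 0 := by
    intro e he
    have hpe := hp e he
    have hqe := hq e he
    simp only [sum_add_distrib]
    have h3 := sum_comm (s := A) (t := S \ A) (f := fun x y =>
      if p e = y ∧ q e = x then (1 : ℤ) else 0)
    rw [h3, hprod, hprod]
    by_cases h1 : p e ∈ A <;> by_cases h2 : q e ∈ A <;> simp [h1, h2, hpe, hqe]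
  unfold cutSum linkCount
  simp only [card_filter, add_zero]
  push_cast
  rw [← sum_congr rfl key, sum_comm (s := B)]
  refine sum_congr rfl fun x _ => ?_
  rw [sum_comm (s := B)]
  exact sum_congr rfl fun y _ => sum_add_distrib.symm

lemma cutSum_linkCount_singleton {S : Finset α} {B : Finset β} {p q : β → α}
    (hp : ∀ e ∈ B, p e ∈ S) (hq : ∀ e ∈ B, q e ∈ S) (hpq : ∀ e ∈ B, p e ≠ q e) (x : α) :
    cutSum S (linkCount B p q) (fun _ => 0) {x} = ∑ e ∈ B, endCount p q e x := by
  rw [cutSum_linkCount hp hq, card_filter]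
  push_cast
  refine sum_congr rfl fun e he => ?_
  have := hpq e he
  unfold endCount
  by_cases h1 : x = p e
  · subst h1
    simp [this, this.symm]
  · by_cases h2 : x = q e
    · subst h2
      simp [this, Ne.symm this]
    · simp [h1, h2, Ne.symm h1, Ne.symm h2]

/-- Edges across `X` cancel in the difference; an edge inside either part counts twice. -/
lemma sum_sum_endCount_sub {S X : Finset α} {E : Finset β} {p q : β → α}
    (hp : ∀ e ∈ E, p e ∈ S) (hq : ∀ e ∈ E, q e ∈ S) (hqp : ∀ e ∈ E, q e ∈ X → p e ∈ X) :
    ∑ x ∈ X, ∑ e ∈ E, endCount p q e x - ∑ x ∈ S \ X, ∑ e ∈ E, endCount p q e x =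
      2 * #{e ∈ E | q e ∈ X} - 2 * #{e ∈ E | p e ∉ X} := by
  rw [sum_comm, sum_comm (s := S \ X), ← sum_sub_distrib, card_filter, card_filter]
  push_cast
  rw [mul_sum, mul_sum, ← sum_sub_distrib]
  refine sum_congr rfl fun e he => ?_
  have h1 := hp e he
  have h2 := hq e he
  have h3 := hqp e he
  rw [sum_endCount, sum_endCount]
  by_cases h4 : p e ∈ X <;> by_cases h5 : q e ∈ X <;> simp_all

set_option maxHeartbeats 1000000 in
/-- Signs on the edges of a multigraph given by the ends `p`, `q` that realize, at every vertex,
one of two prescribed values, when the edges across `X` are highly connected. -/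
lemma exists_edge_signs [DecidableEq β] {S X : Finset α} {E : Finset β} {p q : β → α} {k : ℤ} {f : α → ℤ}
    (hk : 0 < k) (hX : X ⊆ S) (hp : ∀ e ∈ E, p e ∈ S) (hq : ∀ e ∈ E, q e ∈ S)
    (hqp : ∀ e ∈ E, q e ∈ X → p e ∈ X)
    (hcut : ∀ A ⊂ S, A.Nonempty →
      3 * k - 3 ≤ #{e ∈ E | (p e ∈ X ∧ q e ∉ X) ∧ ¬(p e ∈ A ↔ q e ∈ A)})
    (hlow : ∀ x ∈ S, 2 * f x ≤ ∑ e ∈ E, endCount p q e x)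
    (hupp : ∀ x ∈ S, ∑ e ∈ E, endCount p q e x ≤ 2 * f x + 2 * k - 1)
    (hcomp : ∃ t : ℤ, t ≤ #{e ∈ E | q e ∈ X} ∧ -t ≤ #{e ∈ E | p e ∉ X} ∧
      k ∣ ∑ x ∈ X, f x - ∑ x ∈ S \ X, f x - 2 * t) :
    ∃ ε : β → ℤ, (∀ e, ε e = 1 ∨ ε e = -1) ∧ ∀ x ∈ S,
      ∑ e ∈ E, endCount p q e x + ∑ e ∈ E, ε e * endCount p q e x = 2 * f x ∨
      ∑ e ∈ E, endCount p q e x + ∑ e ∈ E, ε e * endCount p q e x = 2 * f x + 2 * k := by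
  set B := {e ∈ E | p e ∈ X ∧ q e ∉ X} with hB
  set N := {e ∈ E | ¬(p e ∈ X ∧ q e ∉ X)} with hN
  set d : α → ℤ := fun x => ∑ e ∈ E, endCount p q e x with hd
  have hsplit (g : β → ℤ) : ∑ e ∈ B, g e + ∑ e ∈ N, g e = ∑ e ∈ E, g e :=
    sum_filter_add_sum_filter_not E _ g
  have hBp : ∀ e ∈ B, p e ∈ S := fun e he => hp e (mem_filter.1 he).1
  have hBq : ∀ e ∈ B, q e ∈ S := fun e he => hq e (mem_filter.1 he).1
  have hBX : ∀ e ∈ B, p e ∈ X ∧ q e ∉ X := fun e he => (mem_filter.1 he).2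
  have hNX : ∀ e ∈ N, p e ∈ X ↔ q e ∈ X := fun e he => by
    have h1 := (mem_filter.1 he).2
    have h2 := hqp e (mem_filter.1 he).1
    tauto
  have hBne : ∀ e ∈ B, p e ≠ q e := fun e he h => (hBX e he).2 (h ▸ (hBX e he).1)
  have hNcard : (#N : ℤ) = #{e ∈ E | q e ∈ X} + #{e ∈ E | p e ∉ X} := by
    rw [hN, card_filter, card_filter, card_filter]
    push_cast
    rw [← sum_add_distrib]
    refine sum_congr rfl fun e he => ?_
    have h3 := hqp e he
    by_cases h4 : p e ∈ X <;> by_cases h5 : q e ∈ X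
    · simp [h4, h5]
    · simp [h4, h5]
    · exact absurd (h3 h5) h4
    · simp [h4, h5]
  have hmem : ∀ {e x}, 0 < endCount p q e x → x = p e ∨ x = q e := by
    intro e x h
    by_contra! hcon
    simp [endCount, hcon.1, hcon.2] at h
  -- Outside `X` contributions are negated, which turns the window `{2f - d, 2f - d + 2k}` into one
  -- starting at `d - 2f - 2k`.
  let c : α → ℤ := fun x => if x ∈ X then 2 * f x - d x else d x - 2 * f x - 2 * k
  have hT : SignedTarget k S (linkCount B p q) N (endCount p q) c := by
    refine ⟨fun x y => add_comm _ _, fun x _ y _ _ => linkCount_nonneg x y, ?_, ?_,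
      ?_, ?_, ?_, ?_, ?_⟩
    · intro A hA hne
      rw [cutSum_linkCount hBp hBq, hB, filter_filter]
      exact hcut A hA hne
    · exact fun e he => ⟨p e, hp e (mem_filter.1 he).1, q e, hq e (mem_filter.1 he).1,
        fun x => rfl⟩
    · intro x hx
      have h1 := hlow x hx
      have h2 := hupp x hx
      simp only [c, hd]
      split_ifs <;> linarith
    · intro x hx
      have h1 := hlow x hx
      have h2 := hupp x hx
      simp only [c, hd]
      split_ifs <;> linarith
    · intro x hx
      rw [cutSum_linkCount_singleton hBp hBq hBne, hsplit]
      change 2 ∣ d x - c x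
      simp only [c]
      split_ifs <;> omega
    · obtain ⟨t, ht1, ht2, j, hj⟩ := hcomp
      -- For `t ≥ 0` this is the total sign after negation outside `X` when `t` edges inside `X` and
      -- no edge outside it are selected; a negative `t` selects `-t` edges outside `X` and none
      -- inside.
      refine ⟨2 * t - #{e ∈ E | q e ∈ X} + #{e ∈ E | p e ∉ X}, ?_, ?_, ?_⟩
      · rw [hNcard, abs_le]
        constructor <;> linarith
      · rw [hNcard]
        exact ⟨#{e ∈ E | q e ∈ X} - t, by ring⟩
      · have h1 : ∑ x ∈ S, c x = ∑ x ∈ X, (2 * f x - d x) +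
            ∑ x ∈ S \ X, (d x - 2 * f x - 2 * k) := by
          rw [← sum_sdiff hX, add_comm]
          congr 1
          · exact sum_congr rfl fun x hx => if_pos hx
          · exact sum_congr rfl fun x hx => if_neg (mem_sdiff.1 hx).2
        have h2 := sum_sum_endCount_sub hp hq hqp
        simp only [sum_sub_distrib, ← mul_sum, sum_const, nsmul_eq_mul] at h1
        refine ⟨j - #(S \ X), ?_⟩
        rw [h1]
        simp only [hd] at *
        linear_combination 2 * hj - h2
    · intro _ e he x hx y hy hcx hcy
      have hxS : x ∈ S := by
        rcases hmem hx with rfl | rfl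
        exacts [hp e (mem_filter.1 he).1, hq e (mem_filter.1 he).1]
      have hyS : y ∈ S := by
        rcases hmem hy with rfl | rfl
        exacts [hp e (mem_filter.1 he).1, hq e (mem_filter.1 he).1]
      have hxy : x ∈ X ↔ y ∈ X := by
        have := hNX e he
        rcases hmem hx with rfl | rfl <;> rcases hmem hy with rfl | rfl <;> tauto
      have h1 := hupp x hxS
      have h2 := hupp y hyS
      simp only [c, hd] at hcx hcy
      -- The strict upper degree bound gives `c > -2k` on `X` and `c < 0` off `X`, and a bidirected
      -- edge has both ends on one side.
      by_cases h : x ∈ X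
      · rw [if_pos (hxy.1 h)] at hcy
        linarith
      · rw [if_neg h] at hcx
        linarith
  obtain ⟨εN, o, hεN, ho, hom, hsum⟩ := hT.hasSigning hk
  have hzero : ∀ x ∈ S, ∀ y ∈ S, (x ∈ X ↔ y ∈ X) → o x y = 0 := by
    intro x hx y hy hxy
    by_cases h : x = y
    · subst h
      have := ho x x
      omega
    · have h1 := (hom x hx y hy h).1
      have h2 : linkCount B p q x y = 0 := by
        unfold linkCount
        rw [filter_false_of_mem, filter_false_of_mem]
        · simp
        · rintro e he ⟨rfl, rfl⟩
          exact (hBX e he).2 (hxy.2 (hBX e he).1)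
        · rintro e he ⟨rfl, rfl⟩
          exact (hBX e he).2 (hxy.1 (hBX e he).1)
      rw [h2] at h1
      exact abs_nonpos_iff.1 h1
  -- The net flow `o x y` is realized by signs of the individual parallel edges.
  have hη : ∀ x y, ∃ η : β → ℤ, (∀ e, η e = 1 ∨ η e = -1) ∧ (x ∈ X → y ∈ S \ X →
      ∑ e ∈ B with p e = x ∧ q e = y, η e = o x y) := by
    intro x y
    by_cases h : x ∈ X ∧ y ∈ S \ X
    · have hy := mem_sdiff.1 h.2
      obtain ⟨h1, h2⟩ := hom x (hX h.1) y hy.1 fun hxy => hy.2 (hxy ▸ h.1)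
      have h3 : linkCount B p q x y = #{e ∈ B | p e = x ∧ q e = y} := by
        unfold linkCount
        rw [add_eq_left, filter_false_of_mem]
        · simp
        · rintro e he ⟨rfl, rfl⟩
          exact hy.2 (hBX e he).1
      rw [h3] at h1 h2
      obtain ⟨η, hη1, hη2⟩ := exists_signs _ _ h1 h2
      exact ⟨η, hη1, fun _ _ => hη2⟩
    · exact ⟨fun _ => 1, fun _ => Or.inl rfl, fun h1 h2 => absurd ⟨h1, h2⟩ h⟩
  choose η hη1 hη2 using hη
  -- The sign of a bidirected edge outside `X` is negated back.
  let ε : β → ℤ := fun e => if p e ∈ X ∧ q e ∉ X then η (p e) (q e) e else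
    if p e ∈ X then εN e else -εN e
  have hεB : ∀ x ∈ X, ∀ y ∈ S \ X, ∑ e ∈ B with p e = x ∧ q e = y, ε e = o x y := by
    intro x hx y hy
    rw [← hη2 x y hx hy]
    refine sum_congr rfl fun e he => ?_
    obtain ⟨heB, rfl, rfl⟩ := mem_filter.1 he
    exact if_pos (hBX e heB)
  refine ⟨ε, fun e => ?_, fun x hx => ?_⟩
  · simp only [ε]
    split_ifs
    · exact hη1 _ _ e
    · exact hεN e
    · rcases hεN e with h | h <;> simp [h]
  · have hs := hsum x hx
    rw [← hsplit (fun e => ε e * endCount p q e x)]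
    change d x + _ = _ ∨ d x + _ = _
    by_cases hxX : x ∈ X
    · have h1 : ∑ e ∈ N, ε e * endCount p q e x = ∑ e ∈ N, εN e * endCount p q e x := by
        refine sum_congr rfl fun e he => ?_
        by_cases hpe : p e ∈ X
        · simp [ε, hpe, (hNX e he).1 hpe]
        · have : endCount p q e x = 0 := by
            have hqe := mt (hNX e he).2 hpe
            simp [endCount, show x ≠ p e by rintro rfl; exact hpe hxX,
              show x ≠ q e by rintro rfl; exact hqe hxX]
          simp [this]
      have h2 : ∑ e ∈ B, ε e * endCount p q e x = ∑ y ∈ S, o x y := by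
        rw [← sum_sdiff hX, sum_eq_zero (s := X) fun y hy =>
          hzero x hx y (hX hy) (by simp [hxX, hy]), add_zero]
        rw [← sum_congr rfl fun y hy => hεB x hxX y hy]
        simp only [← filter_filter]
        rw [sum_fiberwise_of_maps_to (fun e he => ?_)]
        · refine Eq.trans ?_ (sum_filter _ _).symm
          refine sum_congr rfl fun e he => ?_
          have : x ≠ q e := by rintro rfl; exact (hBX e he).2 hxX
          by_cases hxe : p e = x
          · simp [endCount, this, hxe]
          · simp [endCount, this, hxe, Ne.symm hxe]
        · have := (mem_filter.1 he).1
          exact mem_sdiff.2 ⟨hBq e this, (hBX e this).2⟩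
      simp only [c, if_pos hxX] at hs
      rw [h1, h2]
      rcases hs with hs | hs
      · left; linarith
      · right; linarith
    · have h1 : ∑ e ∈ N, ε e * endCount p q e x = -∑ e ∈ N, εN e * endCount p q e x := by
        rw [← sum_neg_distrib]
        refine sum_congr rfl fun e he => ?_
        by_cases hpe : p e ∈ X
        · have : endCount p q e x = 0 := by
            have hqe := (hNX e he).1 hpe
            simp [endCount, show x ≠ p e by rintro rfl; exact hxX hpe,
              show x ≠ q e by rintro rfl; exact hxX hqe]
          simp [this]
        · simp [ε, hpe]
      have h2 : ∑ e ∈ B, ε e * endCount p q e x = -∑ y ∈ S, o x y := by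
        rw [← sum_sdiff hX, sum_eq_zero (s := S \ X) fun y hy =>
          hzero x hx y (mem_sdiff.1 hy).1 (by simp [hxX, (mem_sdiff.1 hy).2]), zero_add,
          ← sum_neg_distrib]
        rw [sum_congr rfl fun y hy => (ho y x).symm.trans
          (hεB y hy x (mem_sdiff.2 ⟨hx, hxX⟩)).symm]
        simp only [and_comm (a := p _ = _), ← filter_filter]
        rw [sum_fiberwise_of_maps_to (fun e he => (hBX e (mem_filter.1 he).1).1)]
        refine Eq.trans ?_ (sum_filter _ _).symm
        refine sum_congr rfl fun e he => ?_
        have : x ≠ p e := by rintro rfl; exact hxX (hBX e he).1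
        by_cases hxe : q e = x
        · simp [endCount, this, hxe]
        · simp [endCount, this, hxe, Ne.symm hxe]
      simp only [c, if_neg hxX] at hs
      rw [h1, h2]
      rcases hs with hs | hs
      · right; linarith
      · left; linarith

end BipartiteCut

/-! ### Translation to `Graph` with chosen ends for each edge. -/

namespace Graph

variable {α β : Type*} {G : Graph α β} {E : Finset β} {p q : β → α}

lemma isLink_iff_ends (hE : E(G) = E) (hl : ∀ e ∈ E, G.IsLink e (p e) (q e)) {e : β} {x y : α} :
    G.IsLink e x y ↔ e ∈ E ∧ (p e = x ∧ q e = y ∨ p e = y ∧ q e = x) := by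
  refine ⟨fun h => ?_, ?_⟩
  · have he : e ∈ E := by
      rw [← mem_coe, ← hE]
      exact h.edge_mem
    exact ⟨he, (hl e he).isLink_iff.1 h⟩
  · rintro ⟨he, ⟨rfl, rfl⟩ | ⟨rfl, rfl⟩⟩
    exacts [hl e he, (hl e he).symm]

lemma degree_eq_sum_endCount [DecidableEq α] (hE : E(G) = E) (hl : ∀ e ∈ E, G.IsLink e (p e) (q e)) (v : α) :
    (G.degree v : ℤ) = ∑ e ∈ E, endCount p q e v := by
  have h1 : {e | G.IsNonloopAt e v} = ↑({e ∈ E | ¬(p e = v ↔ q e = v)}) := by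
    ext e
    simp only [IsNonloopAt, isLink_iff_ends hE hl, Set.mem_ofPred_eq, coe_filter]
    constructor
    · rintro ⟨y, hy, he, ⟨rfl, rfl⟩ | ⟨rfl, rfl⟩⟩
      · exact ⟨he, by simp [hy]⟩
      · exact ⟨he, by simp [hy]⟩
    · rintro ⟨he, h⟩
      by_cases hp : p e = v
      · exact ⟨q e, by tauto, he, Or.inl ⟨hp, rfl⟩⟩
      · exact ⟨p e, hp, he, Or.inr ⟨rfl, by tauto⟩⟩
  have h2 : {e | G.IsLoopAt e v} = ↑({e ∈ E | p e = v ∧ q e = v}) := by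
    ext e
    simp only [IsLoopAt, isLink_iff_ends hE hl, Set.mem_ofPred_eq, coe_filter, or_self]
  rw [degree, h1, h2, Set.ncard_coe_finset, Set.ncard_coe_finset, card_filter, card_filter]
  push_cast
  rw [mul_sum, ← sum_add_distrib]
  refine sum_congr rfl fun e _ => ?_
  unfold endCount
  simp only [eq_comm (a := v)]
  by_cases h1 : p e = v <;> by_cases h2 : q e = v <;> simp [h1, h2]

lemma ncard_edgeCut [DecidableEq α] (hE : E(G) = E) (hl : ∀ e ∈ E, G.IsLink e (p e) (q e)) (A : Finset α) :
    (G.edgeCut A).ncard = #{e ∈ E | ¬(p e ∈ A ↔ q e ∈ A)} := by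
  rw [← Set.ncard_coe_finset]
  congr 1
  ext e
  simp only [edgeCut, isLink_iff_ends hE hl, Set.mem_ofPred_eq, coe_filter, mem_coe]
  constructor
  · rintro ⟨x, hx, y, hy, he, ⟨rfl, rfl⟩ | ⟨rfl, rfl⟩⟩
    · exact ⟨he, by tauto⟩
    · exact ⟨he, by tauto⟩
  · rintro ⟨he, h⟩
    by_cases hp : p e ∈ A
    · exact ⟨p e, hp, q e, by tauto, he, Or.inl ⟨rfl, rfl⟩⟩
    · exact ⟨q e, by tauto, p e, hp, he, Or.inr ⟨rfl, rfl⟩⟩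

lemma numEdgesIn_eq_card [DecidableEq α] (hE : E(G) = E) (hl : ∀ e ∈ E, G.IsLink e (p e) (q e)) (A : Finset α) :
    G.numEdgesIn A = #{e ∈ E | p e ∈ A ∧ q e ∈ A} := by
  rw [numEdgesIn, ← Set.ncard_coe_finset]
  congr 1
  ext e
  simp only [isLink_iff_ends hE hl, Set.mem_ofPred_eq, coe_filter, mem_coe]
  constructor
  · rintro ⟨x, hx, y, hy, he, ⟨rfl, rfl⟩ | ⟨rfl, rfl⟩⟩
    · exact ⟨he, hx, hy⟩
    · exact ⟨he, hy, hx⟩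
  · rintro ⟨he, hp, hq⟩
    exact ⟨p e, hp, q e, hq, he, Or.inl ⟨rfl, rfl⟩⟩

/-- One integer covers both alternatives of compatibility: `t = x` for edges inside `X`, `t = -y`
for edges inside `Y`. -/
lemma IsCompatibleWrt.exists_dvd {k : ℕ} {f : α → ℕ} {X Y : Finset α}
    (h : G.IsCompatibleWrt (fun v => (f v : ZMod k)) X Y) :
    ∃ t : ℤ, t ≤ G.numEdgesIn X ∧ -t ≤ G.numEdgesIn Y ∧
      (k : ℤ) ∣ ∑ v ∈ X, (f v : ℤ) - ∑ v ∈ Y, (f v : ℤ) - 2 * t := by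
  rcases h with ⟨x, hx, h⟩ | ⟨y, hy, h⟩
  · refine ⟨x, by exact_mod_cast hx, by omega, ?_⟩
    rw [← ZMod.intCast_zmod_eq_zero_iff_dvd]
    push_cast
    linear_combination h
  · refine ⟨-y, by omega, by simpa using hy, ?_⟩
    rw [← ZMod.intCast_zmod_eq_zero_iff_dvd]
    push_cast
    linear_combination h

/-- In a `(6 * k - 7)`-edge-connected graph, the edges across a maximum cut `X`, directed out of `X`,
form a `(3 * k - 3)`-edge-connected bipartite graph. -/
lemma exists_oriented_max_cut [DecidableEq α] {S : Finset α} (hV : V(G) = S) (hE : E(G) = E) {k : ℤ}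
    (hG : G.IsEdgeConnected (6 * k - 7)) (hl : ∀ e ∈ E, G.IsLink e (p e) (q e)) :
    ∃ X ⊆ S, ∃ p' q' : β → α, (∀ e ∈ E, G.IsLink e (p' e) (q' e)) ∧
      (∀ e ∈ E, q' e ∈ X → p' e ∈ X) ∧ ∀ A ⊂ S, A.Nonempty →
        3 * k - 3 ≤ #{e ∈ E | (p' e ∈ X ∧ q' e ∉ X) ∧ ¬(p' e ∈ A ↔ q' e ∈ A)} := by
  obtain ⟨X, hX, hmax⟩ := exists_two_mul_card_cut_inter_ge S E p q
  refine ⟨X, hX, fun e => if p e ∈ X then p e else q e, fun e => if p e ∈ X then q e else p e,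
    fun e he => ?_, fun e he => ?_, fun A hA hne => ?_⟩
  · dsimp only
    split_ifs
    exacts [hl e he, (hl e he).symm]
  · dsimp only
    split_ifs with h
    · exact fun _ => h
    · exact fun h' => absurd h' h
  · have h1 := hG A (by rw [hV]; exact_mod_cast hA) (by exact_mod_cast hne)
    rw [ncard_edgeCut hE hl] at h1
    have h2 := hmax A hA.subset
    have h3 : {e ∈ E | ¬(p e ∈ X ↔ q e ∈ X) ∧ ¬(p e ∈ A ↔ q e ∈ A)} = {e ∈ E |
        ((if p e ∈ X then p e else q e) ∈ X ∧ (if p e ∈ X then q e else p e) ∉ X) ∧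
        ¬((if p e ∈ X then p e else q e) ∈ A ↔ (if p e ∈ X then q e else p e) ∈ A)} := by
      refine filter_congr fun e _ => ?_
      split_ifs with h <;> simp only [h] <;> tauto
    rw [← h3]
    -- Half of the odd number `6k - 7` rounds up to `3k - 3`.
    omega

end Graph

theorem mainTheorem4 {α β : Type*} (G : Graph α β)
    (hV : G.vertexSet.Finite) (hE : G.edgeSet.Finite)
    (k : ℕ) (hk : 0 < k)
    (hG : G.IsEdgeConnected (6 * (k : ℤ) - 7))
    (f : α → ℕ) (hf : ∀ v ∈ G.vertexSet, 0 < f v)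
    (hcomp : G.IsCompatibleMod (fun v => (f v : ZMod k)))
    (hdeg : ∀ v ∈ G.vertexSet, (f v : ℚ) ≤ (G.degree v : ℚ) / 2 ∧
      (G.degree v : ℚ) / 2 ≤ (f v : ℚ) + (k : ℚ) - 1 / 2) :
    ∃ H : Graph α β, H.IsSpanningSubgraph G ∧
      ∀ v ∈ G.vertexSet, H.degree v = f v ∨ H.degree v = f v + k := by
  classical
  rcases Set.eq_empty_or_nonempty G.vertexSet with hV0 | ⟨v₀, -⟩
  · exact ⟨G, ⟨le_refl G, rfl⟩, by simp [hV0]⟩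
  have : Nonempty α := ⟨v₀⟩
  obtain ⟨S, hS⟩ := hV.exists_finset_coe
  obtain ⟨E, hE⟩ := hE.exists_finset_coe
  have hl : ∀ e ∈ E, ∃ x y, G.IsLink e x y := fun e he =>
    Graph.exists_isLink_of_mem_edgeSet (by rw [← hE]; exact he)
  choose! p₀ q₀ hl₀ using hl
  obtain ⟨X, hX, p, q, hl, hqp, hcut⟩ := Graph.exists_oriented_max_cut hS.symm hE.symm hG hl₀
  have hp : ∀ e ∈ E, p e ∈ S := fun e he => by
    rw [← mem_coe, hS]
    exact (hl e he).left_mem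
  have hq : ∀ e ∈ E, q e ∈ S := fun e he => by
    rw [← mem_coe, hS]
    exact (hl e he).right_mem
  have hd := Graph.degree_eq_sum_endCount hE.symm hl
  have hdeg' : ∀ v ∈ S, 2 * (f v : ℤ) ≤ ∑ e ∈ E, endCount p q e v ∧
      ∑ e ∈ E, endCount p q e v ≤ 2 * (f v : ℤ) + 2 * k - 1 := by
    intro v hv
    rw [← mem_coe, hS] at hv
    obtain ⟨h1, h2⟩ := hdeg v hv
    rw [← hd]
    constructor
    · have : (2 * f v : ℚ) ≤ G.degree v := by linarith
      exact_mod_cast this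
    · have : (G.degree v : ℚ) + 1 ≤ 2 * f v + 2 * k := by linarith
      have : (G.degree v : ℤ) + 1 ≤ 2 * f v + 2 * k := by exact_mod_cast this
      linarith
  obtain ⟨t, ht1, ht2, ht3⟩ := (hcomp X (S \ X) disjoint_sdiff (by
    rw [← hS]
    exact_mod_cast union_sdiff_of_subset hX)).exists_dvd
  rw [Graph.numEdgesIn_eq_card hE.symm hl] at ht1 ht2
  rw [filter_congr (q := fun e => q e ∈ X) fun e he => ⟨fun h => h.2, fun h => ⟨hqp e he h, h⟩⟩]
    at ht1
  rw [filter_congr (q := fun e => p e ∉ X) fun e he => ⟨fun h => (mem_sdiff.1 h.1).2,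
    fun h => ⟨mem_sdiff.2 ⟨hp e he, h⟩, mem_sdiff.2 ⟨hq e he, mt (hqp e he) h⟩⟩⟩] at ht2
  obtain ⟨ε, hε, hsum⟩ := exists_edge_signs (f := fun v => (f v : ℤ)) (by exact_mod_cast hk)
    hX hp hq hqp hcut (fun v hv => (hdeg' v hv).1) (fun v hv => (hdeg' v hv).2)
    ⟨t, ht1, ht2, ht3⟩
  -- Since `1 + ε e` is 2 on the chosen edges and 0 on the others, the signed sum plus `d_G` is
  -- twice the degree in this factor.
  refine ⟨G.restrict {e | ε e = 1}, ⟨Graph.restrict_le, rfl⟩, fun v hv => ?_⟩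
  have hH : ((G.restrict {e | ε e = 1}).degree v : ℤ) =
      ∑ e ∈ E with ε e = 1, endCount p q e v := by
    refine Graph.degree_eq_sum_endCount ?_ (fun e he => ?_) v
    · ext e
      simp [← hE]
    · rw [mem_filter] at he
      simp [hl e he.1, he.2]
  have h2 : 2 * ((G.restrict {e | ε e = 1}).degree v : ℤ) =
      ∑ e ∈ E, endCount p q e v + ∑ e ∈ E, ε e * endCount p q e v := by
    rw [hH, sum_filter, mul_sum, ← sum_add_distrib]
    refine sum_congr rfl fun e _ => ?_
    rcases hε e with h | h
    · rw [if_pos h, h]; ring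
    · rw [if_neg (by omega), h]; ring
  rw [← hS] at hv
  have := hsum v hv
  omega
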